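/- Let $n\ge 0$, let $\mathbb E^n=\mathbb R^n$ be Euclidean space with a fixed orientation, and let $G=\mathrm{Isom}(\mathbb E^n)$ be its isometry group, with $\mathrm{sgn}(g)=\pm1$ the sign of the determinant of the linear part of $g\in G$. A geodesic $k$-simplex is the convex hull of $k+1$ affinely independent points (for $k=-1$ it is empty). A polytope is a finite union of geodesic $n$-simplices in $\mathbb E^n$, any two of which intersect in a geodesic simplex of dimension less than $n$ (possibly empty). The polytope module $\mathrm{Pt}(\mathbb E^n)$ is the abelian group generated by symbols $[P]$, one for each polytope $P\subset\mathbb E^n$, with the relations $[P]=[P']+[P'']$ whenever $P=P'\cup P''$ and $P'\cap P''$ has empty interior; $G$ acts by $g[P]=[g(P)]$. Let $C_*(\mathbb E^n)$ be the chain complex with $C_k(\mathbb E^n)$ the free abelian group on all tuples $(a_0,\dots,a_k)$ of points of $\mathbb E^n$ and $\partial(a_0,\dots,a_k)=\sum_{i=0}^k(-1)^i(a_0,\dots,\widehat{a_i},\dots,a_k)$ for $k\ge1$, with $G$ acting by $g\cdot(a_0,\dots,a_k)=\mathrm{sgn}(g)\,(g(a_0),\dots,g(a_k))$. For an integer $p\ge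 -1$ let $C_*(\mathbb E^n)_p$ be the subcomplex spanned by the tuples whose convex hull is contained in the convex hull of at most $p+1$ points, and let $Gr_n(C_*(\mathbb E^n))=C_*(\mathbb E^n)_n/C_*(\mathbb E^n)_{n-1}$. A tuple $(a_0,\dots,a_n)$ is affinely independent if and only if it does not lie in $C_n(\mathbb E^n)_{n-1}$. There is a homomorphism of $G$-modules $$\phi:C_n(\mathbb E^n)\to\mathrm{Pt}(\mathbb E^n)$$ such that $\phi(a_0,\dots,a_n)=\epsilon\,[P]$ if $a_0,\dots,a_n$ are affinely independent with convex hull $P$, where $\epsilon=1$ if the basis $a_1-a_0,\dots,a_n-a_0$ is positively oriented and $\epsilon=-1$ otherwise, and $\phi(a_0,\dots,a_n)=0$ if $a_0,\dots,a_n$ are affinely dependent. It factors through the degree-$n$ part of $Gr_n(C_*(\mathbb E^n))$ and induces an isomorphism of $G$-modules $$H_n\big(Gr_n(C_*(\mathbb E^n))\big)\xrightarrow{\ \cong\ }\mathrm{Pt}(\mathbb E^n);$$ every tuple $(a_0,\dots,a_n)$ defines a class in $H_n(Gr_n(C_*(\mathbb E^n)))$, and the isomorphism sends this class to $\phi(a_0,\dots,a_n)$.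 -/

import Mathlib

open CategoryTheory

noncomputable section

namespace PolytopeModule

/-- Euclidean `n`-space. -/
abbrev E (n : ℕ) : Type := EuclideanSpace ℝ (Fin n)

/-- The isometry group of Euclidean `n`-space. -/
abbrev Isom (n : ℕ) : Type := E n ≃ᵢ E n

/-! ### The sign of an isometry -/

/-- The linear part of an isometry of Euclidean space. -/
def linearPart {n : ℕ} (g : Isom n) : E n →ₗ[ℝ] E n :=
  g.toRealAffineIsometryEquiv.linear.toLinearMap

theorem linearPart_mul {n : ℕ} (g h : Isom n) :
    linearPart (g * h) = linearPart g ∘ₗ linearPart h := by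
  have : (g * h).toRealAffineIsometryEquiv.toAffineEquiv =
      h.toRealAffineIsometryEquiv.toAffineEquiv.trans
        g.toRealAffineIsometryEquiv.toAffineEquiv := by
    ext x
    simp
  unfold linearPart
  rw [this]
  rfl

theorem linearPart_one {n : ℕ} : linearPart (1 : Isom n) = LinearMap.id := by
  have : (1 : Isom n).toRealAffineIsometryEquiv.toAffineEquiv = AffineEquiv.refl ℝ (E n) := by
    ext x
    simp
  unfold linearPart
  rw [this]
  rfl

/-- `sgn g` is `1` if `g` preserves orientation (its linear part has positive determinant) and
`-1` if it reverses orientation. -/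
def sgn (n : ℕ) : Isom n →* ℤ where
  toFun g := (SignType.sign (LinearMap.det (linearPart g)) : ℤ)
  map_one' := by simp [linearPart_one]
  map_mul' g h := by simp [linearPart_mul, LinearMap.det_comp, sign_mul]

/-! ### Simplices and polytopes -/

/-- `S` is a (nondegenerate) geodesic `k`-simplex: the convex hull of `k + 1` affinely independent
points. The only `(-1)`-simplex is the empty set. -/
def IsSimplex {n : ℕ} (k : ℤ) (S : Set (E n)) : Prop :=
  ∃ s : Finset (E n), AffineIndependent ℝ (fun x : s => (x : E n)) ∧ (s.card : ℤ) = k + 1 ∧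
    S = convexHull ℝ (s : Set (E n))

/-- `P` is a polytope: a finite union of geodesic `n`-simplices in `E n`, any two of which
intersect in a simplex of dimension less than `n` (possibly empty). -/
def IsPolytope {n : ℕ} (P : Set (E n)) : Prop :=
  ∃ (m : ℕ) (Δ : Fin m → Set (E n)), (∀ i, IsSimplex n (Δ i)) ∧
    (∀ i j, i ≠ j → ∃ k : ℤ, k < n ∧ IsSimplex k (Δ i ∩ Δ j)) ∧ P = ⋃ i, Δ i

/-- The type of polytopes in `E n`. -/
def Polytope (n : ℕ) : Type := {P : Set (E n) // IsPolytope P}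

theorem IsSimplex.image {n : ℕ} {k : ℤ} {S : Set (E n)} (hS : IsSimplex k S) (g : Isom n) :
    IsSimplex k (g '' S) := by
  classical
  obtain ⟨s, hs, hc, rfl⟩ := hS
  refine ⟨s.image g, ?_, by rw [Finset.card_image_of_injective _ g.injective, hc], ?_⟩
  · have h1 : AffineIndependent ℝ (fun x : s => g.toRealAffineIsometryEquiv.toAffineEquiv (x : E n)) :=
      (AffineEquiv.affineIndependent_iff g.toRealAffineIsometryEquiv.toAffineEquiv).2 hs
    have h2 := h1.range
    have h3 : Set.range (fun x : s => g.toRealAffineIsometryEquiv.toAffineEquiv (x : E n)) =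
        ((s.image g : Finset (E n)) : Set (E n)) := by
      ext y
      simp
    rw [h3] at h2
    exact h2
  · have := g.toRealAffineIsometryEquiv.toAffineEquiv.toAffineMap.image_convexHull
      (s : Set (E n))
    simpa using this

theorem IsPolytope.image {n : ℕ} {P : Set (E n)} (hP : IsPolytope P) (g : Isom n) :
    IsPolytope (g '' P) := by
  obtain ⟨m, Δ, h1, h2, rfl⟩ := hP
  refine ⟨m, fun i => g '' Δ i, fun i => (h1 i).image g, fun i j hij => ?_, Set.image_iUnion⟩
  obtain ⟨k, hk, hS⟩ := h2 i j hij
  refine ⟨k, hk, ?_⟩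
  rw [← Set.image_inter g.injective]
  exact hS.image g

/-- An isometry `g` sends a polytope `P` to its image `g(P)`. -/
instance (n : ℕ) : MulAction (Isom n) (Polytope n) where
  smul g P := ⟨g '' P.1, P.2.image g⟩
  one_smul _ := Subtype.ext (Set.image_id _)
  mul_smul g h P := Subtype.ext (Set.image_comp g h P.1)

/-- `P` is the interior-disjoint union of `P'` and `P''`. -/
def IsInteriorDisjointUnion {n : ℕ} (P P' P'' : Polytope n) : Prop :=
  P.1 = P'.1 ∪ P''.1 ∧ interior (P'.1 ∩ P''.1) = ∅

/-- The polytope spanned by `n + 1` affinely independent points. -/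
def simplexPolytope {n : ℕ} (a : Fin (n + 1) → E n) (ha : AffineIndependent ℝ a) : Polytope n :=
  ⟨convexHull ℝ (Set.range a), 1, fun _ => convexHull ℝ (Set.range a), fun _ => by
      classical
      refine ⟨Finset.univ.image a, ?_, ?_, by simp⟩
      · have h := ha.range
        have h3 : Set.range a = ((Finset.univ.image a : Finset (E n)) : Set (E n)) := by simp
        rw [h3] at h
        exact h
      · rw [Finset.card_image_of_injective _ ha.injective]
        simp,
    fun i j hij => (hij (Subsingleton.elim i j)).elim, (Set.iUnion_const _).symm⟩

/-! ### The polytope module -/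

/-- The permutation action of `Isom n` on the free abelian group on all polytopes. -/
def freePolytopeAction (n : ℕ) : Representation ℤ (Isom n) (Polytope n →₀ ℤ) where
  toFun g := Finsupp.lmapDomain ℤ ℤ (fun P => g • P)
  map_one' := by
    refine Finsupp.lhom_ext fun P z => ?_
    simp
  map_mul' g h := by
    refine Finsupp.lhom_ext fun P z => ?_
    simp [mul_smul]

theorem freePolytopeAction_single {n : ℕ} (g : Isom n) (P : Polytope n) (z : ℤ) :
    freePolytopeAction n g (Finsupp.single P z) = Finsupp.single (g • P) z := by
  simp [freePolytopeAction]

/-- The subgroup generated by all `[P] - [P'] - [P'']` with `P` the interior-disjoint union of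
`P'` and `P''`. -/
def cutRelations (n : ℕ) : Submodule ℤ (Polytope n →₀ ℤ) :=
  Submodule.span ℤ {x | ∃ P P' P'' : Polytope n, IsInteriorDisjointUnion P P' P'' ∧
    x = Finsupp.single P 1 - Finsupp.single P' 1 - Finsupp.single P'' 1}

theorem IsInteriorDisjointUnion.smul {n : ℕ} {P P' P'' : Polytope n}
    (h : IsInteriorDisjointUnion P P' P'') (g : Isom n) :
    IsInteriorDisjointUnion (g • P) (g • P') (g • P'') := by
  refine ⟨?_, ?_⟩
  · change g '' P.1 = g '' P'.1 ∪ g '' P''.1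
    rw [h.1, Set.image_union]
  · change interior (g '' P'.1 ∩ g '' P''.1) = ∅
    rw [← Set.image_inter g.injective]
    have := g.toHomeomorph.image_interior (P'.1 ∩ P''.1)
    rw [h.2, Set.image_empty] at this
    exact this.symm

theorem cutRelations_le_comap (n : ℕ) (g : Isom n) :
    cutRelations n ≤ (cutRelations n).comap (freePolytopeAction n g) := by
  refine Submodule.span_le.2 ?_
  rintro _ ⟨P, P', P'', h, rfl⟩
  refine Submodule.subset_span ⟨g • P, g • P', g • P'', h.smul g, ?_⟩
  simp [freePolytopeAction_single]

/-- The polytope module, an `Isom n`-module. -/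
def Pt (n : ℕ) : Rep ℤ (Isom n) :=
  Rep.quotient (Rep.of (freePolytopeAction n)) (cutRelations n) (cutRelations_le_comap n)

/-- The class `[P]` of a polytope in the polytope module. -/
def polytopeClass {n : ℕ} (P : Polytope n) : Pt n :=
  (cutRelations n).mkQ (Finsupp.single P 1)

/-! ### The chain complex of simplices, with the twisted action -/

/-- The twisted action of `Isom n` on the free abelian group on `(k + 1)`-tuples of points:
`g` sends `(a₀, …, aₖ)` to `sgn g • (g a₀, …, g aₖ)`. -/
def tupleAction (n k : ℕ) : Representation ℤ (Isom n) ((Fin (k + 1) → E n) →₀ ℤ) where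
  toFun g := sgn n g • Finsupp.lmapDomain ℤ ℤ (fun a => g ∘ a)
  map_one' := by
    refine Finsupp.lhom_ext fun a z => ?_
    simp only [map_one, one_smul, Finsupp.lmapDomain_apply, Finsupp.mapDomain_single]
    rfl
  map_mul' g h := by
    refine Finsupp.lhom_ext fun a z => ?_
    simp only [map_mul, LinearMap.smul_apply, Finsupp.lmapDomain_apply,
      Finsupp.mapDomain_single, Module.End.mul_apply, Finsupp.mapDomain_smul, smul_smul]
    rfl

theorem tupleAction_single {n k : ℕ} (g : Isom n) (a : Fin (k + 1) → E n) :
    tupleAction n k g (Finsupp.single a 1) = sgn n g • Finsupp.single (g ∘ a) (1 : ℤ) := by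
  change (sgn n g • Finsupp.lmapDomain ℤ ℤ (fun a : Fin (k + 1) → E n => g ∘ a))
    (Finsupp.single a 1) = _
  rw [LinearMap.smul_apply, Finsupp.lmapDomain_apply, Finsupp.mapDomain_single]

/-- The alternating boundary map `(a₀, …, aₖ₊₁) ↦ ∑ᵢ (-1)ⁱ (a₀, …, âᵢ, …, aₖ₊₁)`. -/
def boundary (n k : ℕ) :
    ((Fin (k + 1 + 1) → E n) →₀ ℤ) →ₗ[ℤ] ((Fin (k + 1) → E n) →₀ ℤ) :=
  Finsupp.lift _ ℤ _ fun a =>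
    ∑ i : Fin (k + 1 + 1), (-1 : ℤ) ^ (i : ℕ) • Finsupp.single (a ∘ i.succAbove) (1 : ℤ)

theorem boundary_single {n k : ℕ} (a : Fin (k + 1 + 1) → E n) :
    boundary n k (Finsupp.single a 1) =
      ∑ i : Fin (k + 1 + 1), (-1 : ℤ) ^ (i : ℕ) • Finsupp.single (a ∘ i.succAbove) (1 : ℤ) := by
  simp [boundary]

theorem boundary_boundary (n k : ℕ) : boundary n k ∘ₗ boundary n (k + 1) = 0 := by
  ext a : 2
  simp only [LinearMap.comp_apply, Finsupp.lsingle_apply, LinearMap.zero_apply]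
  rw [boundary_single, map_sum]
  simp only [map_smul, boundary_single, Finset.smul_sum, smul_smul]
  rw [← Finset.sum_product', Finset.univ_product_univ]
  refine Finset.sum_involution
    (fun p _ => (p.1.succAbove p.2, p.2.predAbove p.1)) ?_ ?_ (by simp) ?_
  · rintro ⟨i, j⟩ -
    have h1 : (a ∘ (i.succAbove j).succAbove) ∘ (j.predAbove i).succAbove =
        (a ∘ i.succAbove) ∘ j.succAbove := by
      funext x
      simp [Fin.succAbove_succAbove_succAbove_predAbove]
    have h2 := Fin.neg_one_pow_succAbove_add_predAbove (R := ℤ) i j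
    simp only [h1, ← pow_add, h2, ← add_smul]
    simp
  · rintro ⟨i, j⟩ - - h
    exact Fin.succAbove_ne i j (congrArg Prod.fst h)
  · rintro ⟨i, j⟩ -
    simp [Fin.succAbove_succAbove_predAbove, Fin.predAbove_predAbove_succAbove]

theorem boundary_comm (n k : ℕ) (g : Isom n) :
    boundary n k ∘ₗ tupleAction n (k + 1) g = tupleAction n k g ∘ₗ boundary n k := by
  ext a : 2
  simp only [LinearMap.comp_apply, Finsupp.lsingle_apply]
  rw [tupleAction_single, map_smul, boundary_single, boundary_single, map_sum, Finset.smul_sum]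
  refine Finset.sum_congr rfl fun i _ => ?_
  rw [map_smul, tupleAction_single, smul_comm]
  rfl

/-- The boundary map as a morphism of `Isom n`-modules. -/
def boundaryHom (n k : ℕ) : Rep.of (tupleAction n (k + 1)) ⟶ Rep.of (tupleAction n k) :=
  Rep.ofHom ⟨boundary n k, boundary_comm n k⟩

theorem boundaryHom_comp (n k : ℕ) : boundaryHom n (k + 1) ≫ boundaryHom n k = 0 :=
  Rep.hom_ext (Representation.IntertwiningMap.ext (boundary_boundary n k))

/-- The chain complex `C_*(E n)` of (twisted) `Isom n`-modules. -/
def chains (n : ℕ) : ChainComplex (Rep ℤ (Isom n)) ℕ :=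
  ChainComplex.of (fun k => Rep.of (tupleAction n k)) (boundaryHom n) (boundaryHom_comp n)

theorem chains_d (n k : ℕ) : (chains n).d (k + 1) k = boundaryHom n k :=
  ChainComplex.of_d (V := Rep ℤ (Isom n)) (X := fun k => Rep.of (tupleAction n k)) (boundaryHom n)
    k

/-- The tuple `(a₀, …, aₖ)` as an element of `C_k(E n)`. -/
def simplexChain {n k : ℕ} (a : Fin (k + 1) → E n) : (chains n).X k :=
  (Finsupp.single a 1 : (Fin (k + 1) → E n) →₀ ℤ)

/-! ### The filtration and its graded pieces -/

/-- The convex hull of `a₀, …, aₖ` is contained in a (possibly degenerate) geodesic `p`-simplex,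
that is, in the convex hull of at most `p + 1` points. -/
def InSimplex {n k : ℕ} (p : ℤ) (a : Fin (k + 1) → E n) : Prop :=
  ∃ s : Finset (E n), (s.card : ℤ) ≤ p + 1 ∧
    convexHull ℝ (Set.range a) ⊆ convexHull ℝ (s : Set (E n))

/-- `C_k(E n)_p`: the chains on tuples whose convex hull lies in a geodesic `p`-simplex. -/
def filt (n : ℕ) (p : ℤ) (k : ℕ) : Submodule ℤ ((Fin (k + 1) → E n) →₀ ℤ) :=
  Submodule.span ℤ {x | ∃ a : Fin (k + 1) → E n, InSimplex p a ∧ x = Finsupp.single a 1}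

theorem filt_mono (n : ℕ) {p q : ℤ} (hpq : p ≤ q) (k : ℕ) : filt n p k ≤ filt n q k := by
  refine Submodule.span_mono ?_
  rintro _ ⟨a, ⟨s, hs, h⟩, rfl⟩
  exact ⟨a, ⟨s, by omega, h⟩, rfl⟩

theorem filt_le_comap_ρ (n : ℕ) (p : ℤ) (k : ℕ) (g : Isom n) :
    filt n p k ≤ (filt n p k).comap (tupleAction n k g) := by
  classical
  refine Submodule.span_le.2 ?_
  rintro _ ⟨a, ⟨s, hs, h⟩, rfl⟩
  change tupleAction n k g (Finsupp.single a 1) ∈ filt n p k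
  rw [tupleAction_single]
  refine Submodule.smul_mem _ _ (Submodule.subset_span ⟨_, ⟨s.image g, ?_, ?_⟩, rfl⟩)
  · rwa [Finset.card_image_of_injective _ g.injective]
  · have key : ∀ T : Set (E n), g '' convexHull ℝ T = convexHull ℝ (g '' T) := fun T => by
      simpa using g.toRealAffineIsometryEquiv.toAffineEquiv.toAffineMap.image_convexHull T
    rw [Set.range_comp, Finset.coe_image, ← key, ← key]
    exact Set.image_mono h

theorem filt_le_comap_boundary (n : ℕ) (p : ℤ) (k : ℕ) :
    filt n p (k + 1) ≤ (filt n p k).comap (boundary n k) := by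
  refine Submodule.span_le.2 ?_
  rintro _ ⟨a, ⟨s, hs, h⟩, rfl⟩
  change boundary n k (Finsupp.single a 1) ∈ filt n p k
  rw [boundary_single]
  refine Submodule.sum_mem _ fun i _ => Submodule.smul_mem _ _
    (Submodule.subset_span ⟨_, ⟨s, hs, ?_⟩, rfl⟩)
  exact (convexHull_mono (Set.range_comp_subset_range _ _)).trans h

/-- `C_k(E n)_p` as an `Isom n`-module. -/
def filtRep (n : ℕ) (p : ℤ) (k : ℕ) : Rep ℤ (Isom n) :=
  Rep.subrepresentation (Rep.of (tupleAction n k)) (filt n p k) (filt_le_comap_ρ n p k)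

/-- The boundary map restricted to `C_*(E n)_p`. -/
def filtBoundaryHom (n : ℕ) (p : ℤ) (k : ℕ) : filtRep n p (k + 1) ⟶ filtRep n p k :=
  Rep.ofHom ⟨(boundary n k).restrict (filt_le_comap_boundary n p k), fun g =>
    LinearMap.ext fun x => Subtype.ext (LinearMap.congr_fun (boundary_comm n k g) x.1)⟩

theorem filtBoundaryHom_comp (n : ℕ) (p : ℤ) (k : ℕ) :
    filtBoundaryHom n p (k + 1) ≫ filtBoundaryHom n p k = 0 :=
  Rep.hom_ext (Representation.IntertwiningMap.ext (LinearMap.ext fun x =>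
    Subtype.ext (LinearMap.congr_fun (boundary_boundary n k) x.1)))

/-- The subcomplex `C_*(E n)_p` of `C_*(E n)`. -/
def filtChains (n : ℕ) (p : ℤ) : ChainComplex (Rep ℤ (Isom n)) ℕ :=
  ChainComplex.of (filtRep n p) (filtBoundaryHom n p) (filtBoundaryHom_comp n p)

theorem filtChains_d (n : ℕ) (p : ℤ) (k : ℕ) :
    (filtChains n p).d (k + 1) k = filtBoundaryHom n p k :=
  ChainComplex.of_d _ _ _

/-- The inclusion of `C_*(E n)_p` into `C_*(E n)`. -/
def filtι (n : ℕ) (p : ℤ) : filtChains n p ⟶ chains n where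
  f k := Rep.subtype (Rep.of (tupleAction n k)) (filt n p k) (filt_le_comap_ρ n p k)
  comm' := by
    rintro i k rfl
    rw [chains_d, filtChains_d]
    rfl

/-- The inclusion of `C_*(E n)_p` into `C_*(E n)_q` for `p ≤ q`. -/
def filtIncl (n : ℕ) {p q : ℤ} (hpq : p ≤ q) : filtChains n p ⟶ filtChains n q where
  f k := (Rep.ofHom ⟨Submodule.inclusion (filt_mono n hpq k), fun _ => rfl⟩ :
    filtRep n p k ⟶ filtRep n q k)
  comm' := by
    rintro i k rfl
    rw [filtChains_d, filtChains_d]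
    rfl

/-- The `p`-th graded piece `Gr_p C_*(E n) = C_*(E n)_p / C_*(E n)_{p-1}`. -/
def gr (n : ℕ) (p : ℤ) : ChainComplex (Rep ℤ (Isom n)) ℕ :=
  Limits.cokernel (filtIncl n (sub_le_self p zero_le_one))

/-- The projection of `C_*(E n)_p` onto `Gr_p C_*(E n)`. -/
def grπ (n : ℕ) (p : ℤ) : filtChains n p ⟶ gr n p :=
  Limits.cokernel.π (filtIncl n (sub_le_self p zero_le_one))

/-! ### Orientation signs -/

/-- For affinely independent `a₀, …, aₙ` in `E n`, oriented by `o`: `1` if the basis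
`a₁ - a₀, …, aₙ - a₀` is positively oriented and `-1` otherwise. -/
def orientationSign {n : ℕ} (o : Orientation ℝ (E n) (Fin n)) (a : Fin (n + 1) → E n) : ℤ :=
  haveI : Fact (Module.finrank ℝ (E n) = n) := ⟨finrank_euclideanSpace_fin⟩
  if 0 < o.volumeForm (fun i : Fin n => a i.succ - a 0) then 1 else -1

end PolytopeModule

end

open PolytopeModule

/-! Every tuple lies in some `n`-simplex, and a face with `n` points already has filtration `n - 1`.
So the degree-`n` part of `gr n n` is $C_n$ modulo degenerate tuples, its outgoing differential
vanishes, and $H_n$ is $C_n$ modulo degenerate tuples and boundaries (`trivialChains`). It remains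
to see that the signed class map to `Pt n` is onto with exactly this kernel. Triangulating a
polytope gives surjectivity.

Boundaries die (`sum_signedSimplex_mem_cutRelations`): if `n + 2` points have a nondegenerate face,
they satisfy one affine dependence up to scale, with weights the signed face determinants. The faces
opposite positive weights triangulate the convex hull, and so do those opposite negative weights;
the two sums of classes agree.

Nothing else dies (`mem_trivialChains_of_signedSum_eq_zero`): a chain with class zero has a signed
indicator function that vanishes generically. Modulo boundaries, $c$ equals the cone $o * \partial
c$, whose indicator still vanishes generically. Group the cones by the hyperplane of their base.
Crossing one such hyperplane at a generic point, only cones based in it jump, and the jump is the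
signed indicator of the base chain up to sign. That base chain is trivial by induction on dimension,
and coning preserves triviality.

"Generic" means on a residual set. This is stable under finite intersections, holds off a hyperplane
and off a closed set with empty interior, and gives a dense set by Baire. -/

noncomputable section

namespace PolytopeModule

/-! ### Determinants of tuples of points -/

/-- The vector `(1, x)` of homogeneous coordinates of a point, as an affine map. -/
def homog (n : ℕ) : E n →ᵃ[ℝ] (Fin (n + 1) → ℝ) where
  toFun x := Fin.cons 1 x.ofLp
  linear :=
    { toFun := fun x => Fin.cons 0 x.ofLp
      map_add' := fun x y => by
        ext i; refine Fin.cases ?_ (fun j => ?_) i <;> simp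
      map_smul' := fun c x => by
        ext i; refine Fin.cases ?_ (fun j => ?_) i <;> simp }
  map_vadd' p v := by
    ext i; refine Fin.cases ?_ (fun j => ?_) i <;> simp

@[simp] theorem homog_zero {n : ℕ} (x : E n) : homog n x 0 = 1 := rfl

@[simp] theorem homog_succ {n : ℕ} (x : E n) (i : Fin n) : homog n x i.succ = x i := rfl

theorem sum_smul_homog {n : ℕ} {ι : Type*} (s : Finset ι) (w : ι → ℝ) (a : ι → E n) :
    ∑ i ∈ s, w i • homog n (a i) =
      Fin.cons (∑ i ∈ s, w i) (∑ i ∈ s, w i • a i).ofLp := by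
  ext j
  refine Fin.cases ?_ (fun j => ?_) j <;> simp

theorem sum_smul_homog_eq_zero_iff {n : ℕ} {ι : Type*} (s : Finset ι) (w : ι → ℝ) (a : ι → E n) :
    ∑ i ∈ s, w i • homog n (a i) = 0 ↔ ∑ i ∈ s, w i = 0 ∧ ∑ i ∈ s, w i • a i = 0 := by
  rw [sum_smul_homog]
  constructor
  · intro h
    refine ⟨congrFun h 0, ?_⟩
    ext j
    exact congrFun h j.succ
  · rintro ⟨h1, h2⟩
    ext j
    refine Fin.cases ?_ (fun j => ?_) j
    · simpa using h1
    · simp [h2]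

theorem affineIndependent_iff_linearIndependent_homog {n : ℕ} {ι : Type*} [Fintype ι]
    (a : ι → E n) : AffineIndependent ℝ a ↔ LinearIndependent ℝ (fun i => homog n (a i)) := by
  rw [affineIndependent_iff, linearIndependent_iff']
  refine forall_congr' fun s => forall_congr' fun w => ?_
  rw [sum_smul_homog_eq_zero_iff, and_imp]

/-- The determinant of the homogeneous coordinates of `n + 1` points. -/
def volDet {n : ℕ} (a : Fin (n + 1) → E n) : ℝ :=
  Matrix.detRowAlternating (R := ℝ) (fun i => homog n (a i))

theorem volDet_eq_det {n : ℕ} (a : Fin (n + 1) → E n) :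
    volDet a = Matrix.det (Matrix.of fun i => homog n (a i)) := rfl

theorem volDet_ne_zero_iff {n : ℕ} (a : Fin (n + 1) → E n) :
    volDet a ≠ 0 ↔ AffineIndependent ℝ a := by
  rw [affineIndependent_iff_linearIndependent_homog, volDet_eq_det, ← isUnit_iff_ne_zero,
    ← Matrix.isUnit_iff_isUnit_det, ← Matrix.linearIndependent_rows_iff_isUnit]
  rfl

/-- The left side is an alternating function of `N + 1` vectors, and these are linearly dependent
for dimension reasons. This is Cramer's rule without division. -/
theorem sum_alternating_smul_eq_zero {N : ℕ} {W : Type*} [AddCommGroup W] [Module ℝ W]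
    [FiniteDimensional ℝ W] (hW : Module.finrank ℝ W < N + 1) (F : W [⋀^Fin N]→ₗ[ℝ] ℝ)
    (w : Fin (N + 1) → W) :
    ∑ i : Fin (N + 1), ((-1 : ℝ) ^ (i : ℕ) * F (w ∘ i.succAbove)) • w i = 0 := by
  let f : W →ₗ[ℝ] W [⋀^Fin N]→ₗ[ℝ] W :=
    { toFun := fun v => (LinearMap.toSpanSingleton ℝ W v).compAlternatingMap F
      map_add' := fun v v' => by ext; simp
      map_smul' := fun c v => by
        ext
        simp only [LinearMap.compAlternatingMap_apply, LinearMap.toSpanSingleton_apply,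
          AlternatingMap.smul_apply, RingHom.id_apply]
        rw [smul_comm] }
  have h := AlternatingMap.map_linearDependent (AlternatingMap.alternatizeUncurryFin f) w
    (fun hw => by have := hw.fintype_card_le_finrank; simp at this; omega)
  rw [AlternatingMap.alternatizeUncurryFin_apply] at h
  rw [← h]
  refine Finset.sum_congr rfl fun i _ => ?_
  have : f (w i) (i.removeNth w) = F (w ∘ i.succAbove) • w i := rfl
  rw [this, mul_smul, ← Int.cast_smul_eq_zsmul ℝ]
  simp

/-- The affine dependence among `n + 2` points. -/
def radonWeight {n : ℕ} (a : Fin (n + 2) → E n) (i : Fin (n + 2)) : ℝ :=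
  (-1) ^ (i : ℕ) * volDet (a ∘ i.succAbove)

theorem sum_radonWeight_smul_homog {n : ℕ} (a : Fin (n + 2) → E n) :
    ∑ i, radonWeight a i • homog n (a i) = 0 :=
  sum_alternating_smul_eq_zero (by simp) Matrix.detRowAlternating (fun i => homog n (a i))

/-- The determinant as an affine function of the first point. -/
def detAff {n : ℕ} (v : Fin n → E n) : E n →ᵃ[ℝ] ℝ :=
  LinearMap.toAffineMap
    { toFun := fun w => (Matrix.detRowAlternating (R := ℝ)).curryLeft w (fun i => homog n (v i))
      map_add' := fun x y => by rw [map_add]; rfl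
      map_smul' := fun c x => by rw [map_smul]; rfl } |>.comp (homog n)

theorem detAff_apply {n : ℕ} (v : Fin n → E n) (x : E n) :
    detAff v x = volDet (Fin.cons x v : Fin (n + 1) → E n) := by
  change Matrix.detRowAlternating (Matrix.vecCons (homog n x) (fun i => homog n (v i))) = _
  unfold volDet
  congr 1
  ext i j
  refine Fin.cases ?_ (fun i => ?_) i <;> simp

/-- The unnormalised barycentric coordinates of a point with respect to `n + 1` points. -/
def bary {n : ℕ} (a : Fin (n + 1) → E n) (i : Fin (n + 1)) : E n →ᵃ[ℝ] ℝ :=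
  ((-1 : ℝ) ^ (i : ℕ)) • detAff (a ∘ i.succAbove)

theorem bary_apply {n : ℕ} (a : Fin (n + 1) → E n) (i : Fin (n + 1)) (x : E n) :
    bary a i x = (-1) ^ (i : ℕ) * volDet (Fin.cons x (a ∘ i.succAbove) : Fin (n + 1) → E n) := by
  simp [bary, detAff_apply]

/-- Cramer's rule: in the dependence among `x, a₀, …, aₙ` the weight of `x` is `volDet a` and that
of `aᵢ` is `-bary a i x`. Not dividing by `volDet a` keeps the formula valid for degenerate tuples.
-/
theorem volDet_smul_homog {n : ℕ} (a : Fin (n + 1) → E n) (x : E n) :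
    volDet a • homog n x = ∑ i, bary a i x • homog n (a i) := by
  have h := sum_radonWeight_smul_homog (Fin.cons x a : Fin (n + 2) → E n)
  rw [Fin.sum_univ_succ] at h
  have h0 : radonWeight (Fin.cons x a : Fin (n + 2) → E n) 0 = volDet a := by
    simp [radonWeight, Function.comp_def]
  have hs : ∀ i : Fin (n + 1),
      radonWeight (Fin.cons x a : Fin (n + 2) → E n) i.succ = - bary a i x := fun i => by
    have : (Fin.cons x a : Fin (n + 2) → E n) ∘ i.succ.succAbove =
        Fin.cons x (a ∘ i.succAbove) := by
      ext j : 1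
      refine Fin.cases ?_ (fun j => ?_) j <;> simp
    rw [radonWeight, bary_apply, this, Fin.val_succ, pow_succ]
    ring
  rw [h0] at h
  simp only [hs, Fin.cons_zero, Fin.cons_succ, neg_smul, Finset.sum_neg_distrib] at h
  exact add_neg_eq_zero.1 h

theorem sum_bary {n : ℕ} (a : Fin (n + 1) → E n) (x : E n) : ∑ i, bary a i x = volDet a := by
  have h := congrFun (volDet_smul_homog a x) 0
  rw [sum_smul_homog] at h
  simpa using h.symm

theorem sum_bary_smul {n : ℕ} (a : Fin (n + 1) → E n) (x : E n) :
    ∑ i, bary a i x • a i = volDet a • x := by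
  have h := volDet_smul_homog a x
  rw [sum_smul_homog] at h
  ext j
  have := congrFun h j.succ
  simpa using this.symm

theorem bary_vertex {n : ℕ} (a : Fin (n + 1) → E n) (i j : Fin (n + 1)) :
    bary a i (a j) = if i = j then volDet a else 0 := by
  have h0 : ∀ i j, i ≠ j → bary a i (a j) = 0 := fun i j hij => by
    obtain ⟨k, hk⟩ := Fin.exists_succAbove_eq (Ne.symm hij)
    rw [bary_apply]
    refine mul_eq_zero_of_right _ ?_
    unfold volDet
    refine AlternatingMap.map_eq_zero_of_eq _ _ (i := 0) (j := k.succ) ?_ (Fin.succ_ne_zero k).symm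
    simp [hk]
  split_ifs with h
  · subst h
    rw [← sum_bary a (a i), Finset.sum_eq_single_of_mem i (Finset.mem_univ i)]
    exact fun k _ hk => h0 k i hk
  · exact h0 i j h

/-! ### Affine functions -/

theorem affineMap_lineMap_apply {V : Type*} [AddCommGroup V] [Module ℝ V] (A : V →ᵃ[ℝ] ℝ)
    (x y : V) (t : ℝ) : A (AffineMap.lineMap x y t) = (1 - t) * A x + t * A y := by
  rw [AffineMap.apply_lineMap, AffineMap.lineMap_apply_module]; rfl

theorem volDet_mul_affineMap {n : ℕ} (A : E n →ᵃ[ℝ] ℝ) (a : Fin (n + 1) → E n) (x : E n) :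
    volDet a * A x = ∑ i, bary a i x * A (a i) := by
  obtain ⟨c, hA⟩ : ∃ c, ∀ y, A y = A.linear y + c := ⟨A 0, fun y => by
    have := A.map_vadd 0 y
    simpa using this⟩
  simp only [hA, mul_add, Finset.sum_add_distrib, ← Finset.sum_mul, sum_bary]
  have h : A.linear (∑ i, bary a i x • a i) = ∑ i, bary a i x * A.linear (a i) := by
    rw [map_sum]
    exact Finset.sum_congr rfl fun i _ => map_smul _ _ _
  rw [← h, sum_bary_smul, map_smul, smul_eq_mul]


theorem mul_neg_iff_neg_of_pos {c b : ℝ} (hc : 0 < c) : c * b < 0 ↔ b < 0 := by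
  rw [← smul_eq_mul, smul_neg_iff_of_pos_left hc]

/-- The generic value of the signed indicator function of the simplex spanned by `a`. -/
def signedIndicator {n : ℕ} (a : Fin (n + 1) → E n) (x : E n) : ℤ :=
  if ∀ i, 0 < bary a i x then 1 else if ∀ i, bary a i x < 0 then -1 else 0

/-- The coordinates sum to `volDet a = 0`, so they cannot all have the same strict sign. -/
theorem signedIndicator_of_volDet_eq_zero {n : ℕ} {a : Fin (n + 1) → E n} (ha : volDet a = 0)
    (x : E n) : signedIndicator a x = 0 := by
  have h := sum_bary a x
  unfold signedIndicator
  rw [if_neg, if_neg]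
  · intro h'
    have := Finset.sum_neg (fun i _ => h' i) (Finset.univ_nonempty (α := Fin (n + 1)))
    linarith
  · intro h'
    have := Finset.sum_pos (fun i _ => h' i) (Finset.univ_nonempty (α := Fin (n + 1)))
    linarith

theorem signedIndicator_congr_sign {n : ℕ} {a : Fin (n + 1) → E n} {b : Fin (n + 1) → E n}
    {x y : E n} (h : ∀ i, SignType.sign (bary a i x) = SignType.sign (bary b i y)) :
    signedIndicator a x = signedIndicator b y := by
  have h1 : ∀ i, 0 < bary a i x ↔ 0 < bary b i y := fun i => by
    rw [← sign_eq_one_iff, h, sign_eq_one_iff]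
  have h2 : ∀ i, bary a i x < 0 ↔ bary b i y < 0 := fun i => by
    rw [← sign_eq_neg_one_iff, h, sign_eq_neg_one_iff]
  simp only [signedIndicator, h1, h2]

/-! ### Cones -/

theorem bary_cons_zero {n : ℕ} (o : E n) (b : Fin n → E n) (x : E n) :
    bary (Fin.cons o b : Fin (n + 1) → E n) 0 x = detAff b x := by
  simp [bary_apply, detAff_apply, Function.comp_def]

theorem volDet_cons_cons_swap {n : ℕ} (x y : E (n + 1)) (c : Fin n → E (n + 1)) :
    volDet (Fin.cons x (Fin.cons y c : Fin (n + 1) → E (n + 1)) : Fin (n + 2) → E (n + 1)) =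
      - volDet (Fin.cons y (Fin.cons x c : Fin (n + 1) → E (n + 1)) : Fin (n + 2) → E (n + 1)) := by
  unfold volDet
  rw [← AlternatingMap.map_swap _ _ (show (0 : Fin (n + 2)) ≠ 1 by simp)]
  congr 1
  ext i : 1
  refine Fin.cases ?_ (fun i => ?_) i
  · simp
  · refine Fin.cases ?_ (fun i => ?_) i
    · simp
    · have : Equiv.swap (0 : Fin (n + 2)) 1 i.succ.succ = i.succ.succ :=
        Equiv.swap_apply_of_ne_of_ne (Fin.succ_ne_zero _) (by
          rw [← Fin.succ_zero_eq_one, Ne, Fin.succ_inj]; exact Fin.succ_ne_zero _)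
      simp [this]

/-- Exchanging `x` with the apex views the coordinate as a function of the apex; the sign of the
swap absorbs the index shift. -/
theorem bary_cons_succ {m : ℕ} (o : E (m + 1)) (b : Fin (m + 1) → E (m + 1)) (i : Fin (m + 1))
    (x : E (m + 1)) :
    bary (Fin.cons o b : Fin (m + 2) → E (m + 1)) i.succ x =
      (-1) ^ (i : ℕ) * detAff (Fin.cons x (b ∘ i.succAbove)) o := by
  have : (Fin.cons o b : Fin (m + 2) → E (m + 1)) ∘ i.succ.succAbove =
      Fin.cons o (b ∘ i.succAbove) := by
    ext j : 1
    refine Fin.cases ?_ (fun j => ?_) j <;> simp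
  rw [bary_apply, this, volDet_cons_cons_swap, detAff_apply, Fin.val_succ, pow_succ]
  ring

/-- An affine map in homogeneous coordinates. -/
theorem exists_linearMap_homog {m k : ℕ} (ι : E m →ᵃ[ℝ] E k) :
    ∃ ℓ : (Fin (m + 1) → ℝ) →ₗ[ℝ] (Fin (k + 1) → ℝ), ∀ y, ℓ (homog m y) = homog k (ι y) := by
  refine ⟨LinearMap.smulRight (LinearMap.proj 0) (homog k (ι 0)) +
    (homog k).linear ∘ₗ ι.linear ∘ₗ (WithLp.linearEquiv 2 ℝ (Fin m → ℝ)).symm.toLinearMap ∘ₗ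
      LinearMap.funLeft ℝ ℝ Fin.succ, fun y => ?_⟩
  have h1 : (WithLp.linearEquiv 2 ℝ (Fin m → ℝ)).symm (LinearMap.funLeft ℝ ℝ Fin.succ (homog m y))
      = y := by
    ext i; simp [LinearMap.funLeft_apply]
  have h2 := ((homog k).comp ι).map_vadd 0 y
  simp only [LinearMap.add_apply, LinearMap.smulRight_apply, LinearMap.proj_apply, homog_zero,
    one_smul, LinearMap.comp_apply, LinearEquiv.coe_coe, h1]
  simp only [vadd_eq_add, add_zero, AffineMap.comp_apply, AffineMap.comp_linear,
    LinearMap.comp_apply] at h2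
  rw [h2]
  exact add_comm _ _

/-- In homogeneous coordinates the left side is an alternating form of top degree on a space of
dimension `m + 1`, hence a multiple of the determinant. The constant `κ` plays the role of the
signed height of `o` over the hyperplane parametrised by `ι`. -/
theorem exists_volDet_cons_comp {m : ℕ} (ι : E m →ᵃ[ℝ] E (m + 1)) (o : E (m + 1)) :
    ∃ κ : ℝ, ∀ b : Fin (m + 1) → E m, detAff (ι ∘ b) o = κ * volDet b := by
  obtain ⟨ℓ, hℓ⟩ := exists_linearMap_homog ι
  let F := ((Matrix.detRowAlternating (R := ℝ) (n := Fin (m + 2))).curryLeft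
    (homog (m + 1) o)).compLinearMap ℓ
  refine ⟨F (Pi.basisFun ℝ (Fin (m + 1))), fun b => ?_⟩
  have h := congrArg (fun G => G (fun i => homog m (b i)))
    (F.eq_smul_basis_det (Pi.basisFun ℝ (Fin (m + 1))))
  have h2 : F (fun i => homog m (b i)) = detAff (ι ∘ b) o := by
    change Matrix.detRowAlternating (Matrix.vecCons (homog (m + 1) o)
      (fun i => ℓ (homog m (b i)))) = _
    simp only [hℓ]
    rfl
  rw [← h2]
  simpa [Pi.basisFun_det, volDet] using h

theorem volDet_comp_eq_zero {m : ℕ} (ι : E m →ᵃ[ℝ] E (m + 1)) (a : Fin (m + 2) → E m) :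
    volDet (ι ∘ a) = 0 := by
  obtain ⟨ℓ, hℓ⟩ := exists_linearMap_homog ι
  have := AlternatingMap.map_linearDependent
    ((Matrix.detRowAlternating (R := ℝ) (n := Fin (m + 2))).compLinearMap ℓ)
    (fun i => homog m (a i)) (fun hw => by have := hw.fintype_card_le_finrank; simp at this)
  rw [AlternatingMap.compLinearMap_apply] at this
  simp only [hℓ] at this
  exact this

/-- An affine function on the segment from `ι x` to the apex is fixed by its end values. A base
coordinate vanishes at the apex, which gives the factor `1 - t`; the apex coordinate vanishes on the
base hyperplane, which gives the factor `t` in the next lemma. -/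
theorem bary_cons_comp_succ {m : ℕ} (ι : E m →ᵃ[ℝ] E (m + 1)) (o : E (m + 1)) {κ : ℝ}
    (hκ : ∀ b : Fin (m + 1) → E m, detAff (ι ∘ b) o = κ * volDet b) (b : Fin (m + 1) → E m)
    (i : Fin (m + 1)) (x : E m) (t : ℝ) :
    bary (Fin.cons o (ι ∘ b) : Fin (m + 2) → E (m + 1)) i.succ (AffineMap.lineMap (ι x) o t) =
      (1 - t) * (κ * bary b i x) := by
  have h : (Fin.cons (ι x) ((ι ∘ b) ∘ i.succAbove) : Fin (m + 1) → E (m + 1)) =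
      ι ∘ (Fin.cons x (b ∘ i.succAbove) : Fin (m + 1) → E m) := by
    ext j : 1
    refine Fin.cases ?_ (fun j => ?_) j <;> simp
  have h0 := bary_vertex (Fin.cons o (ι ∘ b) : Fin (m + 2) → E (m + 1)) i.succ 0
  rw [if_neg (Fin.succ_ne_zero i), Fin.cons_zero] at h0
  rw [affineMap_lineMap_apply, h0, bary_cons_succ, h, hκ, bary_apply]
  ring

theorem bary_cons_comp_zero {m : ℕ} (ι : E m →ᵃ[ℝ] E (m + 1)) (o : E (m + 1)) {κ : ℝ}
    (hκ : ∀ b : Fin (m + 1) → E m, detAff (ι ∘ b) o = κ * volDet b) (b : Fin (m + 1) → E m)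
    (x : E m) (t : ℝ) :
    bary (Fin.cons o (ι ∘ b) : Fin (m + 2) → E (m + 1)) 0 (AffineMap.lineMap (ι x) o t) =
      t * (κ * volDet b) := by
  have h : (Fin.cons (ι x) (ι ∘ b) : Fin (m + 2) → E (m + 1)) =
      ι ∘ (Fin.cons x b : Fin (m + 2) → E m) := by
    ext j : 1
    refine Fin.cases ?_ (fun j => ?_) j <;> simp
  rw [bary_cons_zero, affineMap_lineMap_apply, hκ, detAff_apply, h, volDet_comp_eq_zero]
  ring

/-- On the apex side, the base coordinates are positive multiples of `κ` times those of `x`. The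
apex coordinate adds no condition, because `volDet b` is the sum of the coordinates of `x`. -/
theorem signedIndicator_cons_comp_of_pos {m : ℕ} (ι : E m →ᵃ[ℝ] E (m + 1)) (o : E (m + 1)) {κ : ℝ}
    (hκ : ∀ b : Fin (m + 1) → E m, detAff (ι ∘ b) o = κ * volDet b) (b : Fin (m + 1) → E m)
    (x : E m) {t : ℝ} (ht0 : 0 < t) (ht1 : t < 1) :
    signedIndicator (Fin.cons o (ι ∘ b) : Fin (m + 2) → E (m + 1)) (AffineMap.lineMap (ι x) o t) =
      SignType.sign κ * signedIndicator b x := by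
  have hs := sum_bary b x
  have ht : 0 < 1 - t := by linarith
  have hne := Finset.univ_nonempty (α := Fin (m + 1))
  simp only [signedIndicator, Fin.forall_fin_succ (n := m + 1), bary_cons_comp_zero ι o hκ,
    bary_cons_comp_succ ι o hκ, mul_pos_iff_of_pos_left ht0, mul_pos_iff_of_pos_left ht,
    mul_neg_iff_neg_of_pos ht0, mul_neg_iff_neg_of_pos ht]
  have h1 : (∀ i, 0 < bary b i x) → 0 < volDet b := fun h => by
    rw [← hs]; exact Finset.sum_pos (fun i _ => h i) hne
  have h2 : (∀ i, bary b i x < 0) → volDet b < 0 := fun h => by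
    rw [← hs]; exact Finset.sum_neg (fun i _ => h i) hne
  rcases lt_trichotomy κ 0 with hk | hk | hk
  · have e1 : ∀ y, 0 < κ * y ↔ y < 0 := fun y => by
      rw [mul_pos_iff]; exact ⟨fun h => by rcases h with h | h <;> linarith [h.1, h.2],
        fun h => Or.inr ⟨hk, h⟩⟩
    have e2 : ∀ y, κ * y < 0 ↔ 0 < y := fun y => by
      rw [mul_neg_iff]; exact ⟨fun h => by rcases h with h | h <;> linarith [h.1, h.2],
        fun h => Or.inr ⟨hk, h⟩⟩
    simp only [e1, e2, and_iff_right_of_imp h1, and_iff_right_of_imp h2, sign_neg hk]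
    by_cases h3 : ∀ i, 0 < bary b i x
    · have h4 : ¬ ∀ i, bary b i x < 0 := fun h => by linarith [h1 h3, h2 h]
      rw [if_neg h4, if_pos h3, if_pos h3]; rfl
    · by_cases h4 : ∀ i, bary b i x < 0
      · rw [if_pos h4, if_neg h3, if_pos h4]; rfl
      · rw [if_neg h4, if_neg h3, if_neg h3, if_neg h4]; rfl
  · subst hk
    simp
  · simp only [mul_pos_iff_of_pos_left hk, mul_neg_iff_neg_of_pos hk,
      and_iff_right_of_imp h1, and_iff_right_of_imp h2, sign_pos hk]
    simp

/-- Beyond the base, the apex coordinate has the sign opposite to any common sign of the base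
coordinates. -/
theorem signedIndicator_cons_comp_of_neg {m : ℕ} (ι : E m →ᵃ[ℝ] E (m + 1)) (o : E (m + 1)) {κ : ℝ}
    (hκ : ∀ b : Fin (m + 1) → E m, detAff (ι ∘ b) o = κ * volDet b) (b : Fin (m + 1) → E m)
    (x : E m) {t : ℝ} (ht : t < 0) :
    signedIndicator (Fin.cons o (ι ∘ b) : Fin (m + 2) → E (m + 1)) (AffineMap.lineMap (ι x) o t) =
      0 := by
  have hs := sum_bary b x
  have ht' : 0 < 1 - t := by linarith
  have hne := Finset.univ_nonempty (α := Fin (m + 1))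
  simp only [signedIndicator, Fin.forall_fin_succ (n := m + 1), bary_cons_comp_zero ι o hκ,
    bary_cons_comp_succ ι o hκ, mul_pos_iff_of_pos_left ht', mul_neg_iff_neg_of_pos ht']
  rw [← hs, Finset.mul_sum, if_neg, if_neg]
  · rintro ⟨h1, h2⟩
    have := mul_pos_of_neg_of_neg ht (Finset.sum_neg (fun i _ => h2 i) hne)
    linarith
  · rintro ⟨h1, h2⟩
    have := mul_neg_of_neg_of_pos ht (Finset.sum_pos (fun i _ => h2 i) hne)
    linarith

/-! ### Chains with vanishing signed indicator function -/

/-- The signed indicator function of a chain. -/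
def signedSum (n : ℕ) : ((Fin (n + 1) → E n) →₀ ℤ) →ₗ[ℤ] (E n → ℤ) :=
  Finsupp.linearCombination ℤ signedIndicator

theorem signedSum_apply {n : ℕ} (c : (Fin (n + 1) → E n) →₀ ℤ) (x : E n) :
    signedSum n c x = c.sum fun a z => z * signedIndicator a x := by
  simp [signedSum, Finsupp.linearCombination_apply, Finsupp.sum, Finset.sum_apply]

theorem signedSum_single {n : ℕ} (a : Fin (n + 1) → E n) (x : E n) :
    signedSum n (Finsupp.single a 1) x = signedIndicator a x := by
  simp [signedSum]

/-- The sum of the degenerate chains and the boundaries. -/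
def trivialChains (n : ℕ) : Submodule ℤ ((Fin (n + 1) → E n) →₀ ℤ) :=
  Submodule.span ℤ {x | ∃ a : Fin (n + 1) → E n, volDet a = 0 ∧ x = Finsupp.single a 1} ⊔
    LinearMap.range (boundary n n)

theorem single_mem_trivialChains {n : ℕ} {a : Fin (n + 1) → E n} (ha : volDet a = 0) :
    Finsupp.single a 1 ∈ trivialChains n :=
  Submodule.mem_sup_left (Submodule.subset_span ⟨a, ha, rfl⟩)

theorem boundary_mem_trivialChains {n : ℕ} (c : (Fin (n + 1 + 1) → E n) →₀ ℤ) :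
    boundary n n c ∈ trivialChains n :=
  Submodule.mem_sup_right ⟨c, rfl⟩

/-- The cone over a chain. -/
def cone {n : ℕ} (o : E n) (k : ℕ) :
    ((Fin k → E n) →₀ ℤ) →ₗ[ℤ] ((Fin (k + 1) → E n) →₀ ℤ) :=
  Finsupp.lmapDomain ℤ ℤ (fun b => Fin.cons o b)

theorem cone_single {n : ℕ} (o : E n) (k : ℕ) (b : Fin k → E n) (z : ℤ) :
    cone o k (Finsupp.single b z) = Finsupp.single (Fin.cons o b) z := by
  simp [cone]

theorem boundary_cone {n k : ℕ} (o : E n) (c : (Fin (k + 1 + 1) → E n) →₀ ℤ) :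
    boundary n (k + 1) (cone o _ c) = c - cone o _ (boundary n k c) := by
  suffices h : boundary n (k + 1) ∘ₗ cone o (k + 1 + 1) =
      LinearMap.id - cone o (k + 1) ∘ₗ boundary n k from LinearMap.congr_fun h c
  ext a : 2
  simp only [LinearMap.comp_apply, Finsupp.lsingle_apply, LinearMap.sub_apply, LinearMap.id_apply,
    cone_single, boundary_single, map_sum, map_smul]
  rw [Fin.sum_univ_succ, sub_eq_add_neg, ← Finset.sum_neg_distrib]
  congr 1
  · simp [Function.comp_def]
  · refine Finset.sum_congr rfl fun i _ => ?_
    have : (Fin.cons o a : Fin (k + 1 + 1 + 1) → E n) ∘ i.succ.succAbove =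
        Fin.cons o (a ∘ i.succAbove) := by
      ext j : 1
      refine Fin.cases ?_ (fun j => ?_) j <;> simp
    rw [this, Fin.val_succ, pow_succ, mul_neg_one, neg_smul]

/-- The push-forward of chains along a map. -/
def pushChain {m n : ℕ} (f : E m → E n) (k : ℕ) :
    ((Fin k → E m) →₀ ℤ) →ₗ[ℤ] ((Fin k → E n) →₀ ℤ) :=
  Finsupp.lmapDomain ℤ ℤ (fun b => f ∘ b)

theorem pushChain_single {m n : ℕ} (f : E m → E n) (k : ℕ) (b : Fin k → E m) (z : ℤ) :
    pushChain f k (Finsupp.single b z) = Finsupp.single (f ∘ b) z := by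
  simp [pushChain]

theorem boundary_pushChain {m n k : ℕ} (f : E m → E n) (c : (Fin (k + 1 + 1) → E m) →₀ ℤ) :
    boundary n k (pushChain f _ c) = pushChain f _ (boundary m k c) := by
  suffices h : boundary n k ∘ₗ pushChain f (k + 1 + 1) = pushChain f (k + 1) ∘ₗ boundary m k from
    LinearMap.congr_fun h c
  ext a : 2
  simp only [LinearMap.comp_apply, Finsupp.lsingle_apply, pushChain_single, boundary_single,
    map_sum, map_smul]
  rfl

/-- This carries the inductive conclusion in a hyperplane back to the ambient space: cones over
degenerate tuples are degenerate, and cones over boundaries are handled by the cone formula. -/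
theorem cone_pushChain_mem_trivialChains {m : ℕ} (ι : E m →ᵃ[ℝ] E (m + 1)) (o : E (m + 1))
    {c : (Fin (m + 1) → E m) →₀ ℤ} (hc : c ∈ trivialChains m) :
    cone o _ (pushChain ι _ c) ∈ trivialChains (m + 1) := by
  suffices h : trivialChains m ≤ (trivialChains (m + 1)).comap (cone o _ ∘ₗ pushChain ι _) from
    h hc
  refine sup_le (Submodule.span_le.2 ?_) ?_
  · rintro _ ⟨a, ha, rfl⟩
    change cone o _ (pushChain ι _ _) ∈ trivialChains (m + 1)
    rw [pushChain_single, cone_single]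
    obtain ⟨κ, hκ⟩ := exists_volDet_cons_comp ι o
    refine single_mem_trivialChains ?_
    rw [← detAff_apply, hκ, ha, mul_zero]
  · rintro _ ⟨d, rfl⟩
    change cone o _ (pushChain ι _ (boundary m m d)) ∈ trivialChains (m + 1)
    -- $o * \partial d = d - \partial(o * d)$, and the tuples of `d` are degenerate once pushed into
    -- the hyperplane: `m + 2` points in the image of `E m`.
    rw [← boundary_pushChain, ← sub_sub_cancel (pushChain ι _ d) (cone o _ _), ← boundary_cone]
    refine Submodule.sub_mem _ ?_ (boundary_mem_trivialChains _)
    induction d using Finsupp.induction_linear with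
    | zero => simp
    | add x y hx hy => rw [map_add]; exact Submodule.add_mem _ hx hy
    | single a z =>
      rw [pushChain_single, ← mul_one z, ← smul_eq_mul, ← Finsupp.smul_single]
      exact Submodule.smul_mem _ _ (single_mem_trivialChains (volDet_comp_eq_zero ι a))

/-! ### Genericity -/

/-- The nonvanishing set is open, and a zero `y` is approached along the line towards a point where
`A` is nonzero. -/
theorem eventually_residual_affineMap_ne_zero {m : ℕ} (A : E m →ᵃ[ℝ] ℝ) (h : ∃ x, A x ≠ 0) :
    ∀ᶠ x in residual (E m), A x ≠ 0 := by
  have hcont : Continuous A := A.continuous_of_finiteDimensional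
  refine residual_of_dense_open (isOpen_ne_fun hcont continuous_const) fun y => ?_
  obtain ⟨x, hx⟩ := h
  by_cases hy : A y = 0
  · have hlim : Filter.Tendsto (fun t : ℝ => AffineMap.lineMap y x t) (nhdsWithin 0 {0}ᶜ)
        (nhds y) := by
      have : Continuous (fun t : ℝ => AffineMap.lineMap y x t) := AffineMap.lineMap_continuous
      have := this.tendsto 0
      rw [AffineMap.lineMap_apply_zero] at this
      exact this.mono_left nhdsWithin_le_nhds
    refine mem_closure_of_tendsto hlim ?_
    filter_upwards [self_mem_nhdsWithin] with t ht
    rw [affineMap_lineMap_apply, hy, mul_zero, zero_add]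
    exact mul_ne_zero ht hx
  · exact subset_closure hy

theorem eventually_signedIndicator_eq {n : ℕ} {a : Fin (n + 1) → E n} {z : E n}
    (h : volDet a ≠ 0 → ∀ i, bary a i z ≠ 0) :
    ∀ᶠ w in nhds z, signedIndicator a w = signedIndicator a z := by
  by_cases ha : volDet a = 0
  · simp [signedIndicator_of_volDet_eq_zero ha]
  · have : ∀ᶠ w in nhds z, ∀ i, SignType.sign (bary a i w) = SignType.sign (bary a i z) := by
      refine Filter.eventually_all.2 fun i => ?_
      have hc : ContinuousAt (fun w => SignType.sign (bary a i w)) z :=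
        (continuousAt_sign_of_ne_zero (h ha i)).comp
          (bary a i).continuous_of_finiteDimensional.continuousAt
      exact hc.eventually (isOpen_discrete {SignType.sign (bary a i z)} |>.mem_nhds rfl)
    filter_upwards [this] with w hw using signedIndicator_congr_sign hw

/-! ### Hyperplanes -/

/-- `ι` sends the standard simplex to `b`. On the hyperplane the apex coordinate with respect to
`(o, b)` is zero, so the remaining coordinates, normalised, express the point through `b` alone. -/
theorem exists_param_hyperplane {m : ℕ} (b : Fin (m + 1) → E (m + 1)) (o : E (m + 1))
    (hb : detAff b o ≠ 0) :
    ∃ (ι : E m →ᵃ[ℝ] E (m + 1)) (p : Fin (m + 1) → E m), ι ∘ p = b ∧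
      ∀ x, detAff b x = 0 → ∃ y, ι y = x := by
  let L : E m →ₗ[ℝ] E (m + 1) := Fintype.linearCombination ℝ (fun i : Fin m => b i.succ - b 0) ∘ₗ
    (WithLp.linearEquiv 2 ℝ (Fin m → ℝ)).toLinearMap
  let ι : E m →ᵃ[ℝ] E (m + 1) := L.toAffineMap + AffineMap.const ℝ _ (b 0)
  have hι : ∀ y, ι y = ∑ i, y i • (b i.succ - b 0) + b 0 := fun y => rfl
  refine ⟨ι, Fin.cons 0 fun i => EuclideanSpace.single i 1, ?_, fun x hx => ?_⟩
  · ext i : 1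
    refine Fin.cases ?_ (fun i => ?_) i
    · simp [hι]
    · simp [hι]
  · have h1 := sum_bary (Fin.cons o b : Fin (m + 2) → E (m + 1)) x
    have h2 := sum_bary_smul (Fin.cons o b : Fin (m + 2) → E (m + 1)) x
    rw [detAff_apply] at hb
    rw [Fin.sum_univ_succ, bary_cons_zero, hx, zero_add] at h1
    rw [Fin.sum_univ_succ, bary_cons_zero, hx, zero_smul, zero_add] at h2
    set D := volDet (Fin.cons o b : Fin (m + 2) → E (m + 1)) with hD
    set w := fun i : Fin (m + 1) => bary (Fin.cons o b : Fin (m + 2) → E (m + 1)) i.succ x with hw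
    refine ⟨WithLp.toLp 2 fun i => w i.succ / D, ?_⟩
    have h3 : D • x = ∑ i, w i • b i := by rw [← h2]; rfl
    have h4 : ∑ i, w i = D := h1
    rw [Fin.sum_univ_succ] at h3 h4
    rw [hι, ← sub_eq_zero]
    refine (smul_eq_zero_iff_right hb).1 ?_
    have h5 : D • ∑ i : Fin m, (w i.succ / D) • (b i.succ - b 0) =
        ∑ i : Fin m, w i.succ • b i.succ - (∑ i : Fin m, w i.succ) • b 0 := by
      rw [Finset.smul_sum, Finset.sum_smul, ← Finset.sum_sub_distrib]
      refine Finset.sum_congr rfl fun i _ => ?_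
      rw [smul_smul, mul_div_cancel₀ _ hb, smul_sub]
    change D • (∑ i : Fin m, (w i.succ / D) • (b i.succ - b 0) + b 0 - x) = 0
    rw [smul_sub, smul_add, h5, h3]
    rw [← h4, add_smul]
    abel

theorem affineMap_eq_of_eq_on_cone {m : ℕ} {A : E (m + 1) →ᵃ[ℝ] ℝ} {o : E (m + 1)}
    {b : Fin (m + 1) → E (m + 1)} (hb : detAff b o ≠ 0) (ho : A o = 0) (h : ∀ i, A (b i) = 0)
    (x : E (m + 1)) : A x = 0 := by
  have := volDet_mul_affineMap A (Fin.cons o b : Fin (m + 2) → E (m + 1)) x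
  rw [Fin.sum_univ_succ] at this
  simp only [Fin.cons_zero, Fin.cons_succ, ho, h, mul_zero, Finset.sum_const_zero, add_zero] at this
  rw [detAff_apply] at hb
  exact (mul_eq_zero.1 this).resolve_left hb


/-! ### Sorting cones by the hyperplane of their base -/

/-- The affine function cutting out the hyperplane of `b`, normalised to be `1` at `o`. -/
def hyperplaneFun {n : ℕ} (o : E n) (b : Fin n → E n) (x : E n) : ℝ := detAff b x / detAff b o

theorem detAff_vertex {m : ℕ} (b : Fin (m + 1) → E (m + 1)) (i : Fin (m + 1)) :
    detAff b (b i) = 0 := by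
  have := bary_vertex (Fin.cons 0 b : Fin (m + 2) → E (m + 1)) 0 i.succ
  rwa [if_neg (Fin.succ_ne_zero i).symm, bary_cons_zero, Fin.cons_succ] at this

theorem signedSum_cone {m : ℕ} (o : E (m + 1)) (c : (Fin (m + 1) → E (m + 1)) →₀ ℤ)
    (x : E (m + 1)) : signedSum (m + 1) (cone o _ c) x =
      ∑ b ∈ c.support, c b * signedIndicator (Fin.cons o b : Fin (m + 2) → E (m + 1)) x := by
  rw [signedSum_apply, cone, Finsupp.lmapDomain_apply, Finsupp.sum_mapDomain_index]
  · rfl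
  · simp
  · intros; ring

open Classical in
/-- The part of a cone lying over a single hyperplane is trivial. -/
theorem sum_cone_hyperplane_mem_trivialChains {m : ℕ}
    (ih : ∀ c : (Fin (m + 1) → E m) →₀ ℤ, (∀ᶠ x in residual (E m), signedSum m c x = 0) → c ∈ trivialChains m)
    (o : E (m + 1)) (c : (Fin (m + 1) → E (m + 1)) →₀ ℤ)
    (hc : ∀ᶠ x in residual (E (m + 1)), signedSum (m + 1) (cone o _ c) x = 0) (b₀ : Fin (m + 1) → E (m + 1))
    (hb₀ : detAff b₀ o ≠ 0) :
    ∑ b ∈ c.support with hyperplaneFun o b = hyperplaneFun o b₀,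
      c b • Finsupp.single (Fin.cons o b : Fin (m + 2) → E (m + 1)) (1 : ℤ) ∈
        trivialChains (m + 1) := by
  obtain ⟨ι, p, hp, hι⟩ := exists_param_hyperplane b₀ o hb₀
  obtain ⟨κ, hκ⟩ := exists_volDet_cons_comp ι o
  have hκ0 : κ ≠ 0 := by
    rintro rfl
    rw [← hp, hκ, zero_mul] at hb₀
    exact hb₀ rfl
  choose! r hr using hι
  set grp := c.support.filter (fun b => hyperplaneFun o b = hyperplaneFun o b₀) with hgrp
  -- Evaluate the common function at `o`: it is `1` for `b₀`, but would be `0` for a base whose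
  -- hyperplane contains `o`.
  have hgrp_ne : ∀ b ∈ grp, detAff b o ≠ 0 := fun b hb h0 => by
    have := congrFun (Finset.mem_filter.1 hb).2 o
    rw [hyperplaneFun, hyperplaneFun, h0, div_self hb₀] at this
    simp at this
  have hgrp_r : ∀ b ∈ grp, ι ∘ (r ∘ b) = b := fun b hb => by
    ext i : 1
    refine hr _ ?_
    have := congrFun (Finset.mem_filter.1 hb).2 (b i)
    rw [hyperplaneFun, hyperplaneFun, detAff_vertex, zero_div] at this
    exact (div_eq_zero_iff.1 this.symm).resolve_right hb₀
  have hgrp_vol : ∀ b ∈ grp, volDet (r ∘ b) ≠ 0 := fun b hb h0 => by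
    refine hgrp_ne b hb ?_
    rw [← hgrp_r b hb, hκ, h0, mul_zero]
  set c' : (Fin (m + 1) → E m) →₀ ℤ := ∑ b ∈ grp, c b • Finsupp.single (r ∘ b) (1 : ℤ) with hc'
  have hcone : ∑ b ∈ grp, c b • Finsupp.single (Fin.cons o b : Fin (m + 2) → E (m + 1)) (1 : ℤ) =
      cone o _ (pushChain ι _ c') := by
    rw [hc', map_sum, map_sum]
    refine Finset.sum_congr rfl fun b hb => ?_
    rw [map_smul, map_smul, pushChain_single, cone_single, hgrp_r b hb]
  rw [hcone]
  refine cone_pushChain_mem_trivialChains ι o (ih c' ?_)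
  -- The affine functions a generic `x` must avoid: the first family keeps `x` off the facets of the
  -- bases in this hyperplane, the second keeps `ι x` off the facet hyperplanes of all other
  -- nondegenerate cones.
  let S : Set (E m →ᵃ[ℝ] ℝ) :=
    (⋃ b ∈ grp, Set.range fun i => bary (r ∘ b) i) ∪
    (⋃ b ∈ c.support.filter (fun b => ¬ hyperplaneFun o b = hyperplaneFun o b₀ ∧ detAff b o ≠ 0),
      Set.range fun i => (bary (Fin.cons o b : Fin (m + 2) → E (m + 1)) i).comp ι)
  have hSfin : S.Finite :=
    (grp.finite_toSet.biUnion fun _ _ => Set.finite_range _).union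
      ((Finset.finite_toSet _).biUnion fun _ _ => Set.finite_range _)
  have hS : ∀ A ∈ S, ∃ x, A x ≠ 0 := by
    rintro A (hA | hA)
    · simp only [Set.mem_iUnion] at hA
      obtain ⟨b, hb, i, rfl⟩ := hA
      refine ⟨(r ∘ b) i, ?_⟩
      rw [bary_vertex, if_pos rfl]
      exact hgrp_vol b hb
    · simp only [Set.mem_iUnion] at hA
      obtain ⟨b, hb, i, rfl⟩ := hA
      obtain ⟨hb1, hb2, hb3⟩ := Finset.mem_filter.1 hb
      by_contra! h0
      have h0' : ∀ j, bary (Fin.cons o b : Fin (m + 2) → E (m + 1)) i (b₀ j) = 0 := fun j => by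
        rw [← hp]
        exact h0 (p j)
      -- The coordinate vanishes on the whole hyperplane of `b₀`. If it is the apex coordinate, the
      -- two hyperplanes coincide and so do their normalised functions. Otherwise it vanishes at `o`
      -- too, hence everywhere, contradicting its value at its own vertex.
      revert h0'
      refine Fin.cases (fun h0' => ?_) (fun i h0' => ?_) i
      · simp only [bary_cons_zero] at h0'
        refine hb2 (funext fun x => ?_)
        have := affineMap_eq_of_eq_on_cone (A := detAff b₀ o • detAff b - detAff b o • detAff b₀)
          hb₀ (by simp [mul_comm]) (fun i => by simp [h0', detAff_vertex]) x
        simp only [smul_eq_mul, sub_eq_zero, AffineMap.coe_sub, AffineMap.coe_smul, Pi.sub_apply, Pi.smul_apply] at this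
        rw [hyperplaneFun, hyperplaneFun, div_eq_div_iff hb3 hb₀]
        linarith
      · have h1 := bary_vertex (Fin.cons o b : Fin (m + 2) → E (m + 1)) i.succ i.succ
        have h2 := bary_vertex (Fin.cons o b : Fin (m + 2) → E (m + 1)) i.succ 0
        rw [if_neg (Fin.succ_ne_zero i), Fin.cons_zero] at h2
        rw [affineMap_eq_of_eq_on_cone hb₀ h2 h0', if_pos rfl, ← detAff_apply] at h1
        exact hb3 h1.symm
  filter_upwards [(Filter.eventually_all_finite hSfin).2 fun A hA =>
    eventually_residual_affineMap_ne_zero A (hS A hA)] with x hx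
  have hx1 : ∀ b ∈ grp, ∀ i, bary (r ∘ b) i x ≠ 0 := fun b hb i =>
    hx _ (Or.inl (Set.mem_biUnion hb ⟨i, rfl⟩))
  have hx2 : ∀ b ∈ c.support, ¬ hyperplaneFun o b = hyperplaneFun o b₀ → detAff b o ≠ 0 → ∀ i,
      bary (Fin.cons o b : Fin (m + 2) → E (m + 1)) i (ι x) ≠ 0 := fun b hb hb2 hb3 i =>
    hx _ (Or.inr (Set.mem_biUnion (Finset.mem_filter.2 ⟨hb, hb2, hb3⟩) ⟨i, rfl⟩))
  set rest := c.support.filter (fun b => ¬ hyperplaneFun o b = hyperplaneFun o b₀) with hrest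
  -- the simplices over other hyperplanes have locally constant indicator functions near `ι x`
  have hloc : ∀ᶠ t : ℝ in nhds 0, ∀ b ∈ rest,
      ∀ᶠ w in nhds (AffineMap.lineMap (ι x) o t),
        signedIndicator (Fin.cons o b : Fin (m + 2) → E (m + 1)) w =
          signedIndicator (Fin.cons o b : Fin (m + 2) → E (m + 1)) (ι x) := by
    refine (Filter.eventually_all_finset _).2 fun b hb => ?_
    obtain ⟨hb1, hb2⟩ := Finset.mem_filter.1 hb
    have h1 := (eventually_signedIndicator_eq
      (a := (Fin.cons o b : Fin (m + 2) → E (m + 1))) (z := ι x) fun h =>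
        hx2 b hb1 hb2 (by rwa [detAff_apply])).eventually_nhds
    have h2 : Filter.Tendsto (fun t : ℝ => AffineMap.lineMap (ι x) o t) (nhds 0)
        (nhds (ι x)) := by
      have : Continuous (fun t : ℝ => AffineMap.lineMap (ι x) o t) := AffineMap.lineMap_continuous
      have := this.tendsto 0
      rwa [AffineMap.lineMap_apply_zero] at this
    exact h2.eventually h1
  -- hence the sum vanishes on both sides of the hyperplane
  have hzero : ∀ t : ℝ, t ≠ 0 → t < 1 → (∀ b ∈ rest,
      ∀ᶠ w in nhds (AffineMap.lineMap (ι x) o t),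
        signedIndicator (Fin.cons o b : Fin (m + 2) → E (m + 1)) w =
          signedIndicator (Fin.cons o b : Fin (m + 2) → E (m + 1)) (ι x)) →
      ∑ b ∈ grp, c b * signedIndicator (Fin.cons o b : Fin (m + 2) → E (m + 1))
        (AffineMap.lineMap (ι x) o t) +
      ∑ b ∈ rest, c b * signedIndicator (Fin.cons o b : Fin (m + 2) → E (m + 1)) (ι x) = 0 := by
    intro t ht0 ht1 ht
    have h1 : ∀ᶠ w in nhds (AffineMap.lineMap (ι x) o t), ∀ b ∈ grp,
        signedIndicator (Fin.cons o b : Fin (m + 2) → E (m + 1)) w =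
          signedIndicator (Fin.cons o b : Fin (m + 2) → E (m + 1))
            (AffineMap.lineMap (ι x) o t) := by
      refine (Filter.eventually_all_finset _).2 fun b hb =>
        eventually_signedIndicator_eq fun _ i => ?_
      rw [← hgrp_r b hb]
      refine Fin.cases ?_ (fun i => ?_) i
      · rw [bary_cons_comp_zero ι o hκ]
        exact mul_ne_zero ht0 (mul_ne_zero hκ0 (hgrp_vol b hb))
      · rw [bary_cons_comp_succ ι o hκ]
        exact mul_ne_zero (by linarith) (mul_ne_zero hκ0 (hx1 b hb i))
    -- The sum vanishes only generically, perhaps not at this point; density gives a nearby `w`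
    -- where it vanishes and every indicator in play is unchanged.
    obtain ⟨w, hw, hw1, hw2⟩ := (mem_closure_iff_frequently.1
      (dense_of_mem_residual hc (AffineMap.lineMap (ι x) o t))).and_eventually (h1.and ((Filter.eventually_all_finset _).2 ht)) |>.exists
    rw [Set.mem_ofPred_eq, signedSum_cone, ← Finset.sum_filter_add_sum_filter_not c.support
      (fun b => hyperplaneFun o b = hyperplaneFun o b₀)] at hw
    rw [← hw]
    congr 1
    · exact Finset.sum_congr rfl fun b hb => by rw [hw1 b hb]
    · exact Finset.sum_congr rfl fun b hb => by rw [hw2 b hb]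
  obtain ⟨ε, hε, hball⟩ := Metric.eventually_nhds_iff.1 hloc
  set t := min (ε / 2) (1 / 2) with ht
  have ht0 : 0 < t := by positivity
  have htε : t < ε := (min_le_left _ _).trans_lt (by linarith)
  have ht1 : t < 1 := (min_le_right _ _).trans_lt (by norm_num)
  -- Compare the two sides of the hyperplane. At `-t` the cones of `grp` contribute nothing, so
  -- `rest` sums to zero; then at `t` the sum over `grp` vanishes as well.
  have e1 := hzero t ht0.ne' ht1 (hball (by simpa [abs_of_pos ht0] using htε))
  have e2 := hzero (-t) (by linarith) (by linarith) (hball (by simpa [abs_of_pos ht0] using htε))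
  have e3 : ∑ b ∈ grp, c b * signedIndicator (Fin.cons o b : Fin (m + 2) → E (m + 1))
      (AffineMap.lineMap (ι x) o (-t)) = 0 := Finset.sum_eq_zero fun b hb => by
    rw [← hgrp_r b hb, signedIndicator_cons_comp_of_neg ι o hκ _ _ (by linarith), mul_zero]
  have e4 : ∑ b ∈ grp, c b * signedIndicator (Fin.cons o b : Fin (m + 2) → E (m + 1))
      (AffineMap.lineMap (ι x) o t) = SignType.sign κ * signedSum m c' x := by
    rw [hc', map_sum, Finset.sum_apply, Finset.mul_sum]
    refine Finset.sum_congr rfl fun b hb => ?_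
    conv_lhs => rw [← hgrp_r b hb]
    rw [signedIndicator_cons_comp_of_pos ι o hκ _ _ ht0 ht1, map_smul, Pi.smul_apply,
      signedSum_single, smul_eq_mul]
    rw [hgrp_r b hb]
    ring
  have e5 : (SignType.sign κ : ℤ) * signedSum m c' x = 0 := by
    rw [← e4]; linarith
  refine (mul_eq_zero.1 e5).resolve_left ?_
  rcases hκ0.lt_or_gt with h | h
  · simp [sign_neg h]
  · simp [sign_pos h]

-- The cone is the sum of its parts over the distinct base hyperplanes, each of which is trivial
-- separately.
open Classical in
theorem cone_mem_trivialChains {m : ℕ}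
    (ih : ∀ c : (Fin (m + 1) → E m) →₀ ℤ, (∀ᶠ x in residual (E m), signedSum m c x = 0) → c ∈ trivialChains m)
    (o : E (m + 1)) (c : (Fin (m + 1) → E (m + 1)) →₀ ℤ)
    (hc : ∀ᶠ x in residual (E (m + 1)), signedSum (m + 1) (cone o _ c) x = 0) :
    cone o _ c ∈ trivialChains (m + 1) := by
  have h : cone o _ c = ∑ b ∈ c.support,
      c b • Finsupp.single (Fin.cons o b : Fin (m + 2) → E (m + 1)) (1 : ℤ) := by
    simp [cone, Finsupp.lmapDomain_apply, Finsupp.mapDomain, Finsupp.sum]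
  rw [h, ← Finset.sum_fiberwise_of_maps_to (t := c.support.image (hyperplaneFun o))
    (g := hyperplaneFun o) fun b hb => Finset.mem_image_of_mem _ hb]
  refine Submodule.sum_mem _ fun h hh => ?_
  obtain ⟨b₀, -, rfl⟩ := Finset.mem_image.1 hh
  by_cases hb₀ : detAff b₀ o = 0
  -- Division by zero makes the normalised function of `b₀` identically zero. Any `b` sharing it has
  -- `detAff b o / detAff b o = 0`, so its cone is degenerate.
  · refine Submodule.sum_mem _ fun b hb => Submodule.smul_mem _ _ (single_mem_trivialChains ?_)
    have := congrFun (Finset.mem_filter.1 hb).2 o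
    rw [hyperplaneFun, hyperplaneFun, hb₀, div_zero] at this
    rw [← detAff_apply]
    exact (div_eq_zero_iff.1 this).elim id id
  · exact sum_cone_hyperplane_mem_trivialChains ih o c hc b₀ hb₀


theorem mem_trivialChains_zero (c : (Fin (0 + 1) → E 0) →₀ ℤ)
    (hc : ∀ᶠ x in residual (E 0), signedSum 0 c x = 0) : c ∈ trivialChains 0 := by
  obtain ⟨x, hx⟩ := (dense_of_mem_residual hc).nonempty
  have hc' : c = Finsupp.single (fun _ => x) (c fun _ => x) := by
    refine Finsupp.ext fun a => ?_
    rw [Subsingleton.elim a fun _ => x, Finsupp.single_eq_same]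
  have h1 : signedIndicator (fun _ : Fin (0 + 1) => x) x = 1 := by
    rw [signedIndicator, if_pos]
    intro i
    have : bary (fun _ : Fin (0 + 1) => x) i x = 1 := by
      fin_cases i
      simp [bary_apply, volDet_eq_det]
    rw [this]
    exact one_pos
  have h2 : signedSum 0 c x = 0 := hx
  rw [hc', signedSum_apply, Finsupp.sum_single_index (by simp), h1, mul_one] at h2
  rw [hc', h2, Finsupp.single_zero]
  exact Submodule.zero_mem _

/-! ### Convex hulls of finite families -/

theorem mem_convexHull_image_iff {ι V : Type*} [Fintype ι] [AddCommGroup V] [Module ℝ V]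
    (a : ι → V) (S : Set ι) (x : V) :
    x ∈ convexHull ℝ (a '' S) ↔
      ∃ μ : ι → ℝ, (∀ i, 0 ≤ μ i) ∧ (∀ i, i ∉ S → μ i = 0) ∧ ∑ i, μ i = 1 ∧
        ∑ i, μ i • a i = x := by
  classical
  constructor
  · intro hx
    refine convexHull_min (s := a '' S) (t := {x | ∃ μ : ι → ℝ, (∀ i, 0 ≤ μ i) ∧
      (∀ i, i ∉ S → μ i = 0) ∧ ∑ i, μ i = 1 ∧ ∑ i, μ i • a i = x}) ?_ ?_ hx
    · rintro _ ⟨i, hi, rfl⟩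
      refine ⟨Pi.single i 1, fun j => ?_, fun j hj => ?_, by simp, ?_⟩
      · by_cases h : j = i
        · subst h; simp
        · simp [h]
      · exact Pi.single_eq_of_ne (fun h => hj (by rwa [h])) _
      · rw [Finset.sum_eq_single i] <;> simp +contextual
    · rintro _ ⟨μ, h1, h2, h3, rfl⟩ _ ⟨ν, k1, k2, k3, rfl⟩ s t hs ht hst
      refine ⟨fun i => s * μ i + t * ν i, fun i => ?_, fun i hi => ?_, ?_, ?_⟩
      · have := h1 i; have := k1 i; positivity
      · simp [h2 i hi, k2 i hi]
      · rw [Finset.sum_add_distrib, ← Finset.mul_sum, ← Finset.mul_sum, h3, k3]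
        linarith
      · simp only [add_smul, mul_smul, Finset.sum_add_distrib, Finset.smul_sum]
  · rintro ⟨μ, h1, h2, h3, rfl⟩
    have hsub : ∀ i ∉ Finset.univ.filter (· ∈ S), μ i = 0 := fun i hi => h2 i (by simpa using hi)
    rw [← Finset.sum_subset (Finset.subset_univ (Finset.univ.filter (· ∈ S)))
      (fun i _ hi => by rw [hsub i hi, zero_smul])]
    refine (convex_convexHull ℝ _).sum_mem (fun i _ => h1 i) ?_ fun i hi =>
      subset_convexHull ℝ _ ⟨i, (Finset.mem_filter.1 hi).2, rfl⟩
    rw [Finset.sum_subset (Finset.subset_univ (Finset.univ.filter (· ∈ S)))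
      (fun i _ hi => hsub i hi), h3]

/-! ### Circuits of points -/

/-- `w` is an affine dependence among the points `a`, and every affine dependence is a multiple
of `w`. -/
structure IsCircuit {n : ℕ} {ι : Type*} [Fintype ι] (a : ι → E n) (w : ι → ℝ) : Prop where
  sum_eq_zero : ∑ i, w i = 0
  sum_smul_eq_zero : ∑ i, w i • a i = 0
  eq_smul : ∀ μ : ι → ℝ, ∑ i, μ i = 0 → ∑ i, μ i • a i = 0 → ∃ t : ℝ, ∀ i, μ i = t * w i

theorem IsCircuit.neg {n : ℕ} {ι : Type*} [Fintype ι] {a : ι → E n} {w : ι → ℝ}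
    (h : IsCircuit a w) : IsCircuit a (-w) where
  sum_eq_zero := by simp [h.sum_eq_zero]
  sum_smul_eq_zero := by simp [h.sum_smul_eq_zero]
  eq_smul μ h1 h2 := by
    obtain ⟨t, ht⟩ := h.eq_smul μ h1 h2
    exact ⟨-t, fun i => by simp [ht]⟩

/-- Carathéodory's argument: subtract the multiple of `w` given by the least ratio `μ i / w i` over
positive weights. This kills the coefficient at the minimiser and keeps the others nonnegative. -/
theorem IsCircuit.convexHull_eq_iUnion {n : ℕ} {ι : Type*} [Fintype ι] {a : ι → E n} {w : ι → ℝ}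
    (h : IsCircuit a w) (hw : ∃ i, 0 < w i) :
    convexHull ℝ (Set.range a) = ⋃ i ∈ {i | 0 < w i}, convexHull ℝ (a '' {i}ᶜ) := by
  classical
  refine Set.Subset.antisymm (fun x hx => ?_) (Set.iUnion₂_subset fun i _ =>
    convexHull_mono (Set.image_subset_range _ _))
  rw [← Set.image_univ, mem_convexHull_image_iff] at hx
  obtain ⟨μ, h1, -, h3, rfl⟩ := hx
  obtain ⟨i, hi, hmin⟩ := Finset.exists_min_image (Finset.univ.filter fun i => 0 < w i)
    (fun i => μ i / w i) (by obtain ⟨i, hi⟩ := hw; exact ⟨i, by simpa using hi⟩)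
  simp only [Finset.mem_filter, Finset.mem_univ, true_and] at hi hmin
  refine Set.mem_biUnion (show i ∈ {i | 0 < w i} from hi) ?_
  rw [mem_convexHull_image_iff]
  have ht : 0 ≤ μ i / w i := div_nonneg (h1 i) hi.le
  refine ⟨fun j => μ j - μ i / w i * w j, fun j => ?_, fun j hj => ?_, ?_, ?_⟩
  · rcases lt_or_ge 0 (w j) with hj | hj
    · have := hmin j hj
      rw [le_div_iff₀ hj] at this
      linarith
    · have := mul_nonpos_of_nonneg_of_nonpos ht hj
      have := h1 j
      linarith
  · obtain rfl : j = i := by simpa using hj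
    simp only [div_mul_cancel₀ _ hi.ne', sub_self]
  · rw [Finset.sum_sub_distrib, ← Finset.mul_sum, h.sum_eq_zero, h3]
    simp
  · simp only [sub_smul, mul_smul, Finset.sum_sub_distrib, ← Finset.smul_sum, h.sum_smul_eq_zero]
    simp

/-- Two representations `μ`, `ν` of a common point differ by `t * w`. Comparing at `i`, where `μ` is
zero, gives `t ≥ 0`; comparing at `j`, where `ν` is zero, then forces `μ j = 0`. -/
theorem IsCircuit.convexHull_inter {n : ℕ} {ι : Type*} [Fintype ι] {a : ι → E n} {w : ι → ℝ}
    (h : IsCircuit a w) {i j : ι} (hi : 0 < w i) (hj : 0 < w j) :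
    convexHull ℝ (a '' {i}ᶜ) ∩ convexHull ℝ (a '' {j}ᶜ) = convexHull ℝ (a '' {i, j}ᶜ) := by
  refine Set.Subset.antisymm ?_ (Set.subset_inter ?_ ?_)
  · rintro x ⟨hx, hx'⟩
    rw [mem_convexHull_image_iff] at hx hx'
    obtain ⟨μ, h1, h2, h3, rfl⟩ := hx
    obtain ⟨ν, k1, k2, k3, k4⟩ := hx'
    obtain ⟨t, ht⟩ := h.eq_smul (fun k => ν k - μ k) (by rw [Finset.sum_sub_distrib, h3, k3, sub_self])
      (by simp only [sub_smul, Finset.sum_sub_distrib, k4, sub_self])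
    have hμi : μ i = 0 := h2 i (by simp)
    have hνj : ν j = 0 := k2 j (by simp)
    have e1 := ht i
    have e2 := ht j
    have e3 := k1 i
    have e4 := h1 j
    have ht0 : 0 ≤ t := by
      by_contra hneg
      have := mul_neg_of_neg_of_pos (not_le.1 hneg) hi
      linarith
    have hμj : μ j = 0 := by
      have := mul_nonneg ht0 hj.le
      linarith
    rw [mem_convexHull_image_iff]
    refine ⟨μ, h1, fun k hk => ?_, h3, rfl⟩
    simp only [Set.mem_compl_iff, not_not, Set.mem_insert_iff, Set.mem_singleton_iff] at hk
    rcases hk with rfl | rfl <;> assumption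
  · exact convexHull_mono (Set.image_mono (Set.compl_subset_compl.2 (by simp)))
  · exact convexHull_mono (Set.image_mono (Set.compl_subset_compl.2 (by simp)))

/-- A nonzero weight at `i` makes the opposite face affinely independent, so a dependence is
determined by its coefficient at `i`. -/
theorem isCircuit_radonWeight {n : ℕ} (a : Fin (n + 2) → E n) (h : ∃ i, radonWeight a i ≠ 0) :
    IsCircuit a (radonWeight a) := by
  have h0 := sum_radonWeight_smul_homog a
  have h1 := (sum_smul_homog_eq_zero_iff _ _ _).1 h0
  refine ⟨h1.1, h1.2, fun μ hμ1 hμ2 => ?_⟩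
  obtain ⟨i, hi⟩ := h
  have hind : LinearIndependent ℝ fun j : Fin (n + 1) => homog n (a (i.succAbove j)) :=
    (affineIndependent_iff_linearIndependent_homog (a ∘ i.succAbove)).1
      ((volDet_ne_zero_iff _).1 fun h => hi (by rw [radonWeight, h, mul_zero]))
  have hμ : ∑ i, μ i • homog n (a i) = 0 := (sum_smul_homog_eq_zero_iff _ _ _).2 ⟨hμ1, hμ2⟩
  set t := μ i / radonWeight a i with ht
  have hti : μ i - t * radonWeight a i = 0 := by rw [ht, div_mul_cancel₀ _ hi, sub_self]
  have h2 : ∑ j, (μ j - t * radonWeight a j) • homog n (a j) = 0 := by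
    simp only [sub_smul, mul_smul, Finset.sum_sub_distrib, hμ, ← Finset.smul_sum, h0]
    simp
  rw [Fin.sum_univ_succAbove _ i, hti, zero_smul, zero_add] at h2
  have h3 := Fintype.linearIndependent_iff.1 hind _ h2
  refine ⟨t, fun j => ?_⟩
  rcases Fin.eq_self_or_eq_succAbove i j with rfl | ⟨k, rfl⟩
  · linarith
  · linarith [h3 k]

/-! ### Topology of simplices -/

theorem IsSimplex.isClosed {n : ℕ} {k : ℤ} {S : Set (E n)} (h : IsSimplex k S) : IsClosed S := by
  obtain ⟨s, -, -, rfl⟩ := h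
  exact s.finite_toSet.isClosed_convexHull ℝ

theorem IsSimplex.interior_eq_empty {n : ℕ} {k : ℤ} (hk : k < n) {S : Set (E n)}
    (h : IsSimplex k S) : interior S = ∅ := by
  obtain ⟨s, hs, hc, rfl⟩ := h
  rw [← Set.not_nonempty_iff_eq_empty, interior_convexHull_nonempty_iff_affineSpan_eq_top]
  intro htop
  have := (AffineIndependent.affineSpan_eq_top_iff_card_eq_finrank_add_one (k := ℝ) hs).1
    (by simpa using htop)
  simp at this
  omega

theorem isClosed_interior_biUnion_empty {ι X : Type*} [TopologicalSpace X] (s : Finset ι)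
    (F : ι → Set X) (h : ∀ i ∈ s, IsClosed (F i) ∧ interior (F i) = ∅) :
    interior (⋃ i ∈ s, F i) = ∅ := by
  classical
  induction s using Finset.induction_on with
  | empty => simp
  | insert i s hi ih =>
    rw [Finset.set_biUnion_insert, interior_union_isClosed_of_interior_empty
      (h i (Finset.mem_insert_self _ _)).1 (ih fun j hj => h j (Finset.mem_insert_of_mem hj))]
    exact (h i (Finset.mem_insert_self _ _)).2

theorem IsPolytope.isClosed {n : ℕ} {P : Set (E n)} (h : IsPolytope P) : IsClosed P := by
  obtain ⟨m, Δ, h1, -, rfl⟩ := h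
  exact isClosed_iUnion_of_finite fun i => (h1 i).isClosed

/-! ### Classes of polytopes -/

theorem polytopeClass_eq_add {n : ℕ} {P P' P'' : Polytope n}
    (h : IsInteriorDisjointUnion P P' P'') :
    polytopeClass P = polytopeClass P' + polytopeClass P'' := by
  have : (cutRelations n).mkQ
      (Finsupp.single P 1 - Finsupp.single P' 1 - Finsupp.single P'' 1) = 0 :=
    (Submodule.Quotient.mk_eq_zero _).2 (Submodule.subset_span ⟨P, P', P'', h, rfl⟩)
  rw [map_sub, map_sub, sub_sub, sub_eq_zero] at this
  exact this

/-- The empty polytope. -/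
def emptyPolytope (n : ℕ) : Polytope n :=
  ⟨∅, 0, Fin.elim0, fun i => i.elim0, fun i => i.elim0, by simp⟩

theorem polytopeClass_emptyPolytope (n : ℕ) : polytopeClass (emptyPolytope n) = 0 := by
  have := polytopeClass_eq_add (P := emptyPolytope n) (P' := emptyPolytope n)
    (P'' := emptyPolytope n) ⟨(Set.union_self _).symm, by simp [emptyPolytope]⟩
  exact left_eq_add.1 this

theorem isPolytope_biUnion {n : ℕ} {ι : Type*} (s : Finset ι) (Δ : ι → Set (E n))
    (h1 : ∀ i ∈ s, IsSimplex n (Δ i))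
    (h2 : ∀ i ∈ s, ∀ j ∈ s, i ≠ j → ∃ k : ℤ, k < n ∧ IsSimplex k (Δ i ∩ Δ j)) :
    IsPolytope (⋃ i ∈ s, Δ i) := by
  refine ⟨s.card, fun i => Δ (s.equivFin.symm i), fun i => h1 _ (s.equivFin.symm i).2,
    fun i j hij => h2 _ (s.equivFin.symm i).2 _ (s.equivFin.symm j).2 fun h => hij ?_, ?_⟩
  · exact s.equivFin.symm.injective (Subtype.ext h)
  · rw [s.equivFin.symm.surjective.iUnion_comp (fun i : s => Δ i), Set.iUnion_subtype]

/-- The cut relation is binary, so simplices are split off one at a time. The overlap with the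
remaining union is a finite union of closed sets with empty interior. -/
theorem polytopeClass_eq_sum {n : ℕ} {ι : Type*} (s : Finset ι) (Δ : ι → Polytope n)
    (h1 : ∀ i ∈ s, IsSimplex n (Δ i).1)
    (h2 : ∀ i ∈ s, ∀ j ∈ s, i ≠ j → ∃ k : ℤ, k < n ∧ IsSimplex k ((Δ i).1 ∩ (Δ j).1))
    (P : Polytope n) (hP : P.1 = ⋃ i ∈ s, (Δ i).1) :
    polytopeClass P = ∑ i ∈ s, polytopeClass (Δ i) := by
  classical
  induction s using Finset.induction_on generalizing P with
  | empty =>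
    obtain rfl : P = emptyPolytope n := Subtype.ext (by rw [hP]; simp [emptyPolytope])
    rw [polytopeClass_emptyPolytope, Finset.sum_empty]
  | insert i s hi ih =>
    have h1' : ∀ j ∈ s, IsSimplex n (Δ j).1 := fun j hj => h1 j (Finset.mem_insert_of_mem hj)
    have h2' : ∀ j ∈ s, ∀ k ∈ s, j ≠ k → ∃ d : ℤ, d < n ∧ IsSimplex d ((Δ j).1 ∩ (Δ k).1) :=
      fun j hj k hk => h2 j (Finset.mem_insert_of_mem hj) k (Finset.mem_insert_of_mem hk)
    let Q : Polytope n := ⟨⋃ j ∈ s, (Δ j).1, isPolytope_biUnion s (fun j => (Δ j).1) h1' h2'⟩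
    rw [Finset.sum_insert hi, ← ih h1' h2' Q rfl]
    refine polytopeClass_eq_add ⟨by rw [hP, Finset.set_biUnion_insert], ?_⟩
    rw [show (Δ i).1 ∩ Q.1 = ⋃ j ∈ s, (Δ i).1 ∩ (Δ j).1 from Set.inter_iUnion₂ _ _]
    refine isClosed_interior_biUnion_empty s _ fun j hj => ?_
    obtain ⟨k, hk, hS⟩ := h2 i (Finset.mem_insert_self _ _) j (Finset.mem_insert_of_mem hj)
      (fun h => hi (h ▸ hj))
    exact ⟨hS.isClosed, hS.interior_eq_empty hk⟩

theorem isSimplex_convexHull_image {n : ℕ} {ι : Type*} [Fintype ι] (a : ι → E n)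
    (ha : AffineIndependent ℝ a) (s : Finset ι) :
    IsSimplex ((s.card : ℤ) - 1) (convexHull ℝ (a '' s)) := by
  classical
  refine ⟨s.image a, ?_, ?_, by simp⟩
  · have h := (ha.range).mono (Set.image_subset_range a s)
    have h3 : a '' s = ((s.image a : Finset (E n)) : Set (E n)) := by simp
    rw [h3] at h
    exact h
  · rw [Finset.card_image_of_injective _ ha.injective]
    simp

theorem simplexPolytope_isSimplex {n : ℕ} (a : Fin (n + 1) → E n) (ha : AffineIndependent ℝ a) :
    IsSimplex n (simplexPolytope a ha).1 := by
  have := isSimplex_convexHull_image a ha Finset.univ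
  rw [Finset.coe_univ, Set.image_univ, Finset.card_univ, Fintype.card_fin, Nat.cast_succ,
    add_sub_cancel_right] at this
  exact this

theorem exists_simplexPolytope {n : ℕ} {S : Set (E n)} (h : IsSimplex n S) :
    ∃ (a : Fin (n + 1) → E n) (ha : AffineIndependent ℝ a), (simplexPolytope a ha).1 = S := by
  obtain ⟨s, hs, hc, rfl⟩ := h
  let e := s.equivFinOfCardEq (n := n + 1) (by omega)
  refine ⟨fun i => e.symm i, hs.comp_embedding e.symm.toEmbedding, ?_⟩
  change convexHull ℝ (Set.range fun i => ((e.symm i : s) : E n)) = _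
  have := e.symm.surjective.range_comp (fun i : s => (i : E n))
  rw [show (fun i => ((e.symm i : s) : E n)) = (fun i : s => (i : E n)) ∘ e.symm from rfl, this]
  simp

/-! ### The signed class of a tuple -/

open Classical in
/-- The convex hull of an affinely independent tuple; the empty polytope for other tuples. -/
def tuplePolytope {n : ℕ} (a : Fin (n + 1) → E n) : Polytope n :=
  if ha : AffineIndependent ℝ a then simplexPolytope a ha else emptyPolytope n

theorem tuplePolytope_of_affineIndependent {n : ℕ} {a : Fin (n + 1) → E n}
    (ha : AffineIndependent ℝ a) : tuplePolytope a = simplexPolytope a ha := dif_pos ha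

/-- The element of the free abelian group on the polytopes given by a tuple, with its sign. -/
def signedSimplex {n : ℕ} (a : Fin (n + 1) → E n) : Polytope n →₀ ℤ :=
  Finsupp.single (tuplePolytope a) (SignType.sign (volDet a) : ℤ)

open Classical in
theorem IsCircuit.polytopeClass_eq_sum {n : ℕ} {a : Fin (n + 2) → E n} {w : Fin (n + 2) → ℝ}
    (h : IsCircuit a w) (hw : ∃ i, 0 < w i)
    (hind : ∀ i, 0 < w i → AffineIndependent ℝ (a ∘ i.succAbove)) :
    ∃ hP : IsPolytope (convexHull ℝ (Set.range a)),
      polytopeClass ⟨convexHull ℝ (Set.range a), hP⟩ =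
        ∑ i with 0 < w i, polytopeClass (tuplePolytope (a ∘ i.succAbove)) := by
  have hface : ∀ i, 0 < w i → (tuplePolytope (a ∘ i.succAbove)).1 = convexHull ℝ (a '' {i}ᶜ) :=
    fun i hi => by
      rw [tuplePolytope_of_affineIndependent (hind i hi)]
      change convexHull ℝ (Set.range (a ∘ i.succAbove)) = _
      rw [Set.range_comp, Fin.range_succAbove]
  have hU : convexHull ℝ (Set.range a) =
      ⋃ i ∈ Finset.univ.filter (fun i => 0 < w i), (tuplePolytope (a ∘ i.succAbove)).1 := by
    rw [h.convexHull_eq_iUnion hw]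
    refine Set.iUnion_congr fun i => ?_
    simp only [Finset.mem_filter, Finset.mem_univ, true_and]
    exact Set.iUnion_congr fun hi => (hface i hi).symm
  have h1 : ∀ i ∈ Finset.univ.filter (fun i => 0 < w i),
      IsSimplex n (tuplePolytope (a ∘ i.succAbove)).1 := fun i hi => by
    rw [tuplePolytope_of_affineIndependent (hind i (Finset.mem_filter.1 hi).2)]
    exact simplexPolytope_isSimplex _ _
  have h2 : ∀ i ∈ Finset.univ.filter (fun i => 0 < w i),
      ∀ j ∈ Finset.univ.filter (fun i => 0 < w i), i ≠ j → ∃ k : ℤ, k < n ∧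
        IsSimplex k ((tuplePolytope (a ∘ i.succAbove)).1 ∩
          (tuplePolytope (a ∘ j.succAbove)).1) := fun i hi j hj hij => by
    have hi' := (Finset.mem_filter.1 hi).2
    have hj' := (Finset.mem_filter.1 hj).2
    obtain ⟨k, hk⟩ := Fin.exists_succAbove_eq hij.symm
    -- Two of the `n + 2` points are omitted; the other `n` belong to an independent face and span
    -- an `(n - 1)`-simplex.
    refine ⟨(n : ℤ) - 1, by omega, ?_⟩
    rw [hface i hi', hface j hj', h.convexHull_inter hi' hj']
    have := isSimplex_convexHull_image (a ∘ i.succAbove) (hind i hi')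
      ({k}ᶜ : Finset (Fin (n + 1)))
    rw [Set.image_comp] at this
    have himg : i.succAbove '' (({k}ᶜ : Finset (Fin (n + 1))) : Set (Fin (n + 1))) =
        {i, j}ᶜ := by
      ext l
      rcases Fin.eq_self_or_eq_succAbove i l with rfl | ⟨l, rfl⟩
      · simp [Fin.succAbove_ne]
      · rw [← hk]
        simp [Fin.succAbove_ne]
    rw [himg, Finset.card_compl] at this
    simpa using this
  have hP : IsPolytope (convexHull ℝ (Set.range a)) := by
    rw [hU]
    exact isPolytope_biUnion (Finset.univ.filter fun i => 0 < w i)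
      (fun i => (tuplePolytope (a ∘ i.succAbove)).1) h1 h2
  exact ⟨hP, PolytopeModule.polytopeClass_eq_sum (Finset.univ.filter fun i => 0 < w i)
    (fun i => tuplePolytope (a ∘ i.succAbove)) h1 h2 ⟨_, hP⟩ hU⟩

theorem mkQ_signedSimplex {n : ℕ} (a : Fin (n + 1) → E n) :
    (cutRelations n).mkQ (signedSimplex a) =
      (SignType.sign (volDet a) : ℤ) • (polytopeClass (tuplePolytope a) : Pt n) := by
  rw [signedSimplex, ← mul_one (SignType.sign _ : ℤ), ← smul_eq_mul, ← Finsupp.smul_single,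
    map_smul, smul_eq_mul, mul_one]
  rfl

theorem coe_sign_eq_ite_sub_ite (r : ℝ) :
    (SignType.sign r : ℤ) = (if 0 < r then 1 else 0) - (if 0 < -r then 1 else 0) := by
  rcases lt_trichotomy r 0 with h | rfl | h
  · rw [sign_neg h, if_neg h.le.not_gt, if_pos (neg_pos.2 h)]; rfl
  · simp
  · rw [sign_pos h, if_pos h, if_neg (by linarith)]; rfl

open Classical in
/-- The signed classes of the faces of a tuple of `n + 2` points add up to zero. -/
theorem sum_signedSimplex_mem_cutRelations {n : ℕ} (a : Fin (n + 2) → E n) :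
    ∑ i : Fin (n + 2), (-1 : ℤ) ^ (i : ℕ) • signedSimplex (a ∘ i.succAbove) ∈
      cutRelations n := by
  have hsign : ∀ i : Fin (n + 2),
      (-1 : ℤ) ^ (i : ℕ) * SignType.sign (volDet (a ∘ i.succAbove)) =
        SignType.sign (radonWeight a i) := fun i => by
    rw [radonWeight, sign_mul, SignType.coe_mul, sign_pow, SignType.coe_pow]
    simp
  have hind : ∀ i : Fin (n + 2), radonWeight a i ≠ 0 → AffineIndependent ℝ (a ∘ i.succAbove) :=
    fun i hi => (volDet_ne_zero_iff _).1 (mul_ne_zero_iff.1 hi).2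
  have hmk : (cutRelations n).mkQ
      (∑ i : Fin (n + 2), (-1 : ℤ) ^ (i : ℕ) • signedSimplex (a ∘ i.succAbove)) =
      ∑ i, (SignType.sign (radonWeight a i) : ℤ) •
        (polytopeClass (tuplePolytope (a ∘ i.succAbove)) : Pt n) := by
    rw [map_sum]
    refine Finset.sum_congr rfl fun i _ => ?_
    rw [map_smul, mkQ_signedSimplex, ← hsign, mul_smul]
    rfl
  rw [← Submodule.Quotient.mk_eq_zero, ← Submodule.mkQ_apply, hmk]
  -- If all weights vanish, every face is degenerate and each term is zero.
  by_cases hne : ∃ i, radonWeight a i ≠ 0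
  swap
  · push Not at hne
    exact Finset.sum_eq_zero fun i _ => by rw [hne i, sign_zero]; exact zero_smul _ _
  have hc := isCircuit_radonWeight a hne
  have hpos : ∀ w : Fin (n + 2) → ℝ, IsCircuit a w → (∃ i, w i ≠ 0) → ∃ i, 0 < w i :=
    fun w hw ⟨i, hi⟩ => by
      by_contra! h
      exact hi (Finset.sum_eq_zero_iff_of_nonpos (fun i (_ : i ∈ Finset.univ) => h i) |>.1
        hw.sum_eq_zero i (Finset.mem_univ i))
  -- The same hull is triangulated once through `w` and once through `-w`; the two sums are the
  -- positive and negative parts of the signed sum.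
  obtain ⟨hP, e1⟩ := hc.polytopeClass_eq_sum (hpos _ hc hne) fun i hi => hind i hi.ne'
  obtain ⟨_, e2⟩ := hc.neg.polytopeClass_eq_sum (hpos _ hc.neg (by simpa using hne))
    fun i hi => hind i (by simpa using hi.ne')
  simp only [coe_sign_eq_ite_sub_ite, sub_smul, ite_smul, one_smul, zero_smul,
    Finset.sum_sub_distrib]
  rw [← Finset.sum_filter, ← Finset.sum_filter, ← e1]
  exact sub_eq_zero.2 e2

/-! ### Indicator functions of polytopes -/

theorem affineMap_sum_smul {n : ℕ} {ι : Type*} [Fintype ι] (A : E n →ᵃ[ℝ] ℝ) (μ : ι → ℝ)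
    (hμ : ∑ i, μ i = 1) (a : ι → E n) : A (∑ i, μ i • a i) = ∑ i, μ i * A (a i) := by
  obtain ⟨c, hA⟩ : ∃ c, ∀ y, A y = A.linear y + c := ⟨A 0, fun y => by
    have := A.map_vadd 0 y
    simpa using this⟩
  simp only [hA, mul_add, Finset.sum_add_distrib, ← Finset.sum_mul, hμ, one_mul, map_sum, map_smul,
    smul_eq_mul]

theorem bary_sum_smul {n : ℕ} (a : Fin (n + 1) → E n) (μ : Fin (n + 1) → ℝ)
    (hμ : ∑ i, μ i = 1) (i : Fin (n + 1)) :
    bary a i (∑ j, μ j • a j) = μ i * volDet a := by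
  rw [affineMap_sum_smul _ _ hμ, Finset.sum_eq_single i]
  · rw [bary_vertex, if_pos rfl]
  · intro j _ hj
    rw [bary_vertex, if_neg hj.symm, mul_zero]
  · simp

theorem mem_convexHull_range_iff_bary {n : ℕ} {a : Fin (n + 1) → E n} (ha : volDet a ≠ 0)
    (x : E n) : x ∈ convexHull ℝ (Set.range a) ↔ ∀ i, 0 ≤ bary a i x / volDet a := by
  rw [← Set.image_univ, mem_convexHull_image_iff]
  constructor
  · rintro ⟨μ, h1, -, h3, rfl⟩ i
    rw [bary_sum_smul a μ h3, mul_div_cancel_right₀ _ ha]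
    exact h1 i
  · refine fun h => ⟨fun i => bary a i x / volDet a, h, by simp, ?_, ?_⟩
    · rw [← Finset.sum_div, sum_bary, div_self ha]
    · simp only [div_eq_inv_mul, mul_smul, ← Finset.smul_sum, sum_bary_smul]
      rw [smul_smul, inv_mul_cancel₀ ha, one_smul]

/-- Off the facet hyperplanes, lying in the closed simplex means that all coordinates have the
strict sign of `volDet a`. -/
theorem signedIndicator_eq_sign_mul {n : ℕ} (a : Fin (n + 1) → E n) (x : E n)
    (hx : volDet a ≠ 0 → ∀ i, bary a i x ≠ 0) :
    signedIndicator a x =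
      SignType.sign (volDet a) * (tuplePolytope a).1.indicator (fun _ => (1 : ℤ)) x := by
  classical
  by_cases ha : volDet a = 0
  · rw [signedIndicator_of_volDet_eq_zero ha, ha, sign_zero]
    exact (zero_mul _).symm
  have hx := hx ha
  rw [tuplePolytope_of_affineIndependent ((volDet_ne_zero_iff a).1 ha)]
  have hs := sum_bary a x
  have hne := Finset.univ_nonempty (α := Fin (n + 1))
  have h1 : (∀ i, 0 < bary a i x) → 0 < volDet a := fun h => by
    rw [← hs]; exact Finset.sum_pos (fun i _ => h i) hne
  have h2 : (∀ i, bary a i x < 0) → volDet a < 0 := fun h => by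
    rw [← hs]; exact Finset.sum_neg (fun i _ => h i) hne
  have hmem := mem_convexHull_range_iff_bary ha x
  change _ = _ * (convexHull ℝ (Set.range a)).indicator (fun _ => (1 : ℤ)) x
  rw [Set.indicator_apply, signedIndicator]
  rcases lt_or_gt_of_ne ha with h | h
  · have : x ∈ convexHull ℝ (Set.range a) ↔ ∀ i, bary a i x < 0 := by
      rw [hmem]
      refine forall_congr' fun i => ⟨fun h0 => ?_, fun h0 => (div_pos_of_neg_of_neg h0 h).le⟩
      by_contra h3
      have h4 := div_neg_of_pos_of_neg (lt_of_le_of_ne (not_lt.1 h3) (hx i).symm) h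
      linarith
    simp only [this, sign_neg h]
    rw [if_neg fun h3 => by linarith [h1 h3]]
    split_ifs <;> rfl
  · have : x ∈ convexHull ℝ (Set.range a) ↔ ∀ i, 0 < bary a i x := by
      rw [hmem]
      refine forall_congr' fun i => ⟨fun h0 => ?_, fun h0 => (div_pos h0 h).le⟩
      by_contra h3
      have h4 := div_neg_of_neg_of_pos (lt_of_le_of_ne (not_lt.1 h3) (hx i)) h
      linarith
    simp only [this, sign_pos h]
    rw [if_neg (c := ∀ i, bary a i x < 0) fun h3 => by linarith [h2 h3]]
    split_ifs <;> rfl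

theorem eventually_residual_signedIndicator_eq {n : ℕ} (a : Fin (n + 1) → E n) :
    ∀ᶠ x in residual (E n), signedIndicator a x =
      SignType.sign (volDet a) * (tuplePolytope a).1.indicator (fun _ => (1 : ℤ)) x := by
  by_cases ha : volDet a = 0
  · exact Filter.Eventually.of_forall fun x => signedIndicator_eq_sign_mul a x fun h => (h ha).elim
  · have : ∀ᶠ x in residual (E n), ∀ i, bary a i x ≠ 0 :=
      Filter.eventually_all.2 fun i => eventually_residual_affineMap_ne_zero _ ⟨a i, by
        rwa [bary_vertex, if_pos rfl]⟩
    filter_upwards [this] with x hx using signedIndicator_eq_sign_mul a x fun _ => hx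

/-- The function on `E n` defined by a formal sum of polytopes. -/
def polytopeSum (n : ℕ) : (Polytope n →₀ ℤ) →ₗ[ℤ] (E n → ℤ) :=
  Finsupp.linearCombination ℤ fun P => P.1.indicator fun _ => (1 : ℤ)

theorem polytopeSum_single {n : ℕ} (P : Polytope n) (z : ℤ) (x : E n) :
    polytopeSum n (Finsupp.single P z) x = z * P.1.indicator (fun _ => (1 : ℤ)) x := by
  simp [polytopeSum]

/-- Polytopes are closed, so an overlap with empty interior has open dense complement, and there the
indicators add. -/
theorem eventually_residual_polytopeSum_eq_zero {n : ℕ} {c : Polytope n →₀ ℤ}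
    (hc : c ∈ cutRelations n) : ∀ᶠ x in residual (E n), polytopeSum n c x = 0 := by
  induction hc using Submodule.span_induction with
  | mem c hc =>
    obtain ⟨P, P', P'', h, rfl⟩ := hc
    have hd : Dense (P'.1 ∩ P''.1)ᶜ := interior_eq_empty_iff_dense_compl.1 h.2
    filter_upwards [residual_of_dense_open (P'.2.isClosed.inter P''.2.isClosed).isOpen_compl hd]
      with x hx
    rw [map_sub, map_sub, Pi.sub_apply, Pi.sub_apply, polytopeSum_single, polytopeSum_single,
      polytopeSum_single, h.1, Set.indicator_union_of_notMem_inter hx]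
    ring
  | zero => simp
  | add x y _ _ hx hy =>
    filter_upwards [hx, hy] with p hp hq
    rw [map_add, Pi.add_apply, hp, hq, add_zero]
  | smul z x _ hx =>
    filter_upwards [hx] with p hp
    rw [map_smul, Pi.smul_apply, hp, smul_zero]

/-! ### From chains to polytopes: boundaries, kernel and image -/

/-- The formal sum of polytopes of a chain, with signs. -/
def chainToPolytopes (n : ℕ) : ((Fin (n + 1) → E n) →₀ ℤ) →ₗ[ℤ] (Polytope n →₀ ℤ) :=
  Finsupp.linearCombination ℤ signedSimplex

theorem chainToPolytopes_single {n : ℕ} (a : Fin (n + 1) → E n) :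
    chainToPolytopes n (Finsupp.single a 1) = signedSimplex a := by
  simp [chainToPolytopes]

theorem eventually_residual_polytopeSum_chain {n : ℕ} (c : (Fin (n + 1) → E n) →₀ ℤ) :
    ∀ᶠ x in residual (E n), polytopeSum n (chainToPolytopes n c) x = signedSum n c x := by
  induction c using Finsupp.induction_linear with
  | zero => simp
  | add c d hc hd =>
    filter_upwards [hc, hd] with x hx hx'
    simp only [map_add, Pi.add_apply, hx, hx']
  | single a z =>
    filter_upwards [eventually_residual_signedIndicator_eq a] with x hx
    rw [← mul_one z, ← smul_eq_mul, ← Finsupp.smul_single]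
    simp only [map_smul, Pi.smul_apply, chainToPolytopes_single, signedSum_single, hx,
      signedSimplex, polytopeSum_single]

theorem chainToPolytopes_boundary_mem {n : ℕ} (c : (Fin (n + 1 + 1) → E n) →₀ ℤ) :
    chainToPolytopes n (boundary n n c) ∈ cutRelations n := by
  induction c using Finsupp.induction_linear with
  | zero => simp
  | add c d hc hd => rw [map_add, map_add]; exact Submodule.add_mem _ hc hd
  | single a z =>
    rw [← mul_one z, ← smul_eq_mul, ← Finsupp.smul_single, map_smul, map_smul]
    refine Submodule.smul_mem _ _ ?_
    rw [boundary_single, map_sum]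
    simp only [map_smul, chainToPolytopes_single]
    exact sum_signedSimplex_mem_cutRelations a

theorem mem_trivialChains_of_signedSum_eq_zero {n : ℕ} (c : (Fin (n + 1) → E n) →₀ ℤ)
    (hc : ∀ᶠ x in residual (E n), signedSum n c x = 0) : c ∈ trivialChains n := by
  induction n with
  | zero => exact mem_trivialChains_zero c hc
  | succ m ih =>
    have e := boundary_cone (k := m) (0 : E (m + 1)) c
    have h : cone 0 _ (boundary (m + 1) m c) ∈ trivialChains (m + 1) := by
      refine cone_mem_trivialChains ih _ _ ?_
      filter_upwards [hc, eventually_residual_polytopeSum_chain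
        (boundary (m + 1) (m + 1) (cone 0 _ c)), eventually_residual_polytopeSum_eq_zero
        (chainToPolytopes_boundary_mem (cone 0 _ c))] with x h1 h2 h3
      rw [h3, e, map_sub, Pi.sub_apply, h1, zero_sub] at h2
      exact neg_eq_zero.1 h2.symm
    rw [eq_add_of_sub_eq e.symm]
    exact Submodule.add_mem _ (boundary_mem_trivialChains _) h

theorem mem_trivialChains_of_chainToPolytopes_mem {n : ℕ} (c : (Fin (n + 1) → E n) →₀ ℤ)
    (hc : chainToPolytopes n c ∈ cutRelations n) : c ∈ trivialChains n := by
  refine mem_trivialChains_of_signedSum_eq_zero c ?_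
  filter_upwards [eventually_residual_polytopeSum_chain c,
    eventually_residual_polytopeSum_eq_zero hc] with x h1 h2
  rw [← h1, h2]

theorem mkQ_chainToPolytopes_surjective (n : ℕ) :
    Function.Surjective ((cutRelations n).mkQ ∘ₗ chainToPolytopes n) := by
  rw [← LinearMap.range_eq_top, LinearMap.range_comp, eq_top_iff,
    ← (cutRelations n).range_mkQ, LinearMap.range_eq_map]
  rintro _ ⟨x, -, rfl⟩
  induction x using Finsupp.induction_linear with
  | zero => rw [map_zero]; exact Submodule.zero_mem _
  | add c d hc hd => rw [map_add]; exact Submodule.add_mem _ hc hd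
  | single P z =>
    rw [← mul_one z, ← smul_eq_mul, ← Finsupp.smul_single, map_smul]
    refine Submodule.smul_mem _ _ ?_
    obtain ⟨m, Δ, h1, h2, hP⟩ := P.2
    choose a ha haΔ using fun i => exists_simplexPolytope (h1 i)
    have hclass := polytopeClass_eq_sum Finset.univ (fun i => simplexPolytope (a i) (ha i))
      (fun i _ => simplexPolytope_isSimplex _ _)
      (fun i _ j _ hij => by rw [haΔ, haΔ]; exact h2 i j hij) P (by simp [hP, haΔ])
    change polytopeClass P ∈ _
    rw [hclass]
    refine Submodule.sum_mem _ fun i _ => ?_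
    have hvol := (volDet_ne_zero_iff _).2 (ha i)
    -- The sign is applied twice, so it squares to `1` and leaves the bare class of the simplex.
    refine ⟨(SignType.sign (volDet (a i)) : ℤ) • signedSimplex (a i),
      Submodule.smul_mem _ _ ⟨_, chainToPolytopes_single _⟩, ?_⟩
    rw [map_smul, mkQ_signedSimplex, tuplePolytope_of_affineIndependent (ha i)]
    rcases lt_or_gt_of_ne hvol with h | h
    · rw [sign_neg h]
      exact (smul_smul (-1 : ℤ) (-1 : ℤ) _).trans (one_smul _ _)
    · rw [sign_pos h]
      exact (smul_smul (1 : ℤ) (1 : ℤ) _).trans (one_smul _ _)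

/-! ### Orientations and isometries -/

theorem volDet_eq_basis_det {n : ℕ} (a : Fin (n + 1) → E n) :
    volDet a = (EuclideanSpace.basisFun (Fin n) ℝ).toBasis.det (fun i : Fin n => a i.succ - a 0) := by
  let B : Matrix (Fin (n + 1)) (Fin (n + 1)) ℝ :=
    Matrix.of (Fin.cons (homog n (a 0)) fun i => homog n (a i.succ) - homog n (a 0))
  have h1 : volDet a = B.det := by
    rw [volDet_eq_det]
    refine Matrix.det_eq_of_forall_row_eq_smul_add_const (Fin.cons 0 fun _ => 1) 0 rfl fun i j => ?_
    refine Fin.cases ?_ (fun i => ?_) i <;> simp [B]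
  rw [h1, Matrix.det_succ_column_zero, Finset.sum_eq_single 0, Module.Basis.det_apply]
  · rw [← Matrix.det_transpose]
    have h2 : B 0 0 = 1 := rfl
    rw [h2, Fin.val_zero, pow_zero, one_mul, one_mul]
    congr 1
  · intro i _ hi
    obtain ⟨k, rfl⟩ := Fin.exists_succ_eq.2 hi
    simp [B]
  · simp

/-- There are only two orientations, so `s` records whether `o` is the standard one. The choice of
orientation thus enters only as a global sign. -/
theorem orientationSign_eq {n : ℕ} (o : Orientation ℝ (E n) (Fin n)) :
    ∃ s : ℤ, s * s = 1 ∧ ∀ a : Fin (n + 1) → E n, volDet a ≠ 0 →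
      orientationSign o a = s * SignType.sign (volDet a) := by
  have : Fact (Module.finrank ℝ (E n) = n) := ⟨finrank_euclideanSpace_fin⟩
  have key : ∀ a : Fin (n + 1) → E n, orientationSign o a =
    if 0 < o.volumeForm (fun i : Fin n => a i.succ - a 0) then 1 else -1 := fun a => rfl
  by_cases h : (EuclideanSpace.basisFun (Fin n) ℝ).toBasis.orientation = o
  · refine ⟨1, by norm_num, fun a ha => ?_⟩
    rw [key, o.volumeForm_robust _ h, ← volDet_eq_basis_det]
    rcases lt_or_gt_of_ne ha with h | h
    · rw [if_neg (by linarith), sign_neg h]; rfl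
    · rw [if_pos h, sign_pos h]; rfl
  · refine ⟨-1, by norm_num, fun a ha => ?_⟩
    rw [key, o.volumeForm_robust_neg _ h, AlternatingMap.neg_apply, ← volDet_eq_basis_det]
    rcases lt_or_gt_of_ne ha with h | h
    · rw [if_pos (by linarith), sign_neg h]; rfl
    · rw [if_neg (by linarith), sign_pos h]; rfl

theorem linearPart_sub {n : ℕ} (g : Isom n) (x y : E n) : linearPart g (x - y) = g x - g y := by
  have := g.toRealAffineIsometryEquiv.toAffineEquiv.toAffineMap.linearMap_vsub x y
  exact this

theorem volDet_comp_isom {n : ℕ} (g : Isom n) (a : Fin (n + 1) → E n) :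
    volDet (g ∘ a) = LinearMap.det (linearPart g) * volDet a := by
  rw [volDet_eq_basis_det, volDet_eq_basis_det, ← Module.Basis.det_comp]
  congr 1
  ext i : 1
  exact (linearPart_sub g _ _).symm

theorem sgn_mul_self {n : ℕ} (g : Isom n) : sgn n g * sgn n g = 1 := by
  have h0 : LinearMap.det (linearPart g) ≠ 0 :=
    (LinearEquiv.isUnit_det' g.toRealAffineIsometryEquiv.linear).ne_zero
  change (SignType.sign (LinearMap.det (linearPart g)) : ℤ) *
    (SignType.sign (LinearMap.det (linearPart g)) : ℤ) = 1
  rcases lt_or_gt_of_ne h0 with h | h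
  · rw [sign_neg h]; rfl
  · rw [sign_pos h]; rfl

/-- The determinant changes sign by `sgn n g`, and the twist in the action on tuples cancels this;
hence `Pt n` carries the untwisted action. -/
theorem signedSimplex_comp_isom {n : ℕ} (g : Isom n) (a : Fin (n + 1) → E n) :
    sgn n g • signedSimplex (g ∘ a) = freePolytopeAction n g (signedSimplex a) := by
  by_cases ha : volDet a = 0
  · simp [signedSimplex, volDet_comp_isom, ha]
  have ha' := (volDet_ne_zero_iff a).1 ha
  have hga : AffineIndependent ℝ (g ∘ a) :=
    (AffineEquiv.affineIndependent_iff g.toRealAffineIsometryEquiv.toAffineEquiv).2 ha'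
  have hP : tuplePolytope (g ∘ a) = g • tuplePolytope a := by
    rw [tuplePolytope_of_affineIndependent ha', tuplePolytope_of_affineIndependent hga]
    refine Subtype.ext ?_
    change convexHull ℝ (Set.range (g ∘ a)) = g '' convexHull ℝ (Set.range a)
    rw [Set.range_comp]
    have := g.toRealAffineIsometryEquiv.toAffineEquiv.toAffineMap.image_convexHull (Set.range a)
    simpa using this.symm
  rw [signedSimplex, signedSimplex, freePolytopeAction_single, hP, Finsupp.smul_single,
    volDet_comp_isom, sign_mul, SignType.coe_mul, smul_eq_mul, ← mul_assoc]
  have := sgn_mul_self g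
  rw [show (SignType.sign (LinearMap.det (linearPart g)) : ℤ) = sgn n g from rfl, this, one_mul]

theorem chainToPolytopes_tupleAction {n : ℕ} (g : Isom n) (c : (Fin (n + 1) → E n) →₀ ℤ) :
    chainToPolytopes n (tupleAction n n g c) = freePolytopeAction n g (chainToPolytopes n c) := by
  suffices h : chainToPolytopes n ∘ₗ tupleAction n n g =
    freePolytopeAction n g ∘ₗ chainToPolytopes n from LinearMap.congr_fun h c
  ext a : 2
  simp only [LinearMap.comp_apply, Finsupp.lsingle_apply]
  rw [tupleAction_single, map_smul, chainToPolytopes_single, chainToPolytopes_single,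
    signedSimplex_comp_isom]

/-! ### Tuples in simplices -/

/-- Finitely many points have bounded coefficients along the `v i`, so they fit in one large simplex
with corner `q` and edges `K • v i`. The `v i` need not be independent. -/
theorem exists_finset_convexHull {V : Type*} [AddCommGroup V] [Module ℝ V] {d m : ℕ} (p : V)
    (v : Fin d → V) (a : Fin (m + 1) → V) (c : Fin (m + 1) → Fin d → ℝ)
    (ha : ∀ k, a k = p + ∑ i, c k i • v i) :
    ∃ s : Finset V, s.card ≤ d + 1 ∧ convexHull ℝ (Set.range a) ⊆ convexHull ℝ (s : Set V) := by
  classical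
  let R : ℝ := ∑ k, ∑ i, |c k i|
  have hR : ∀ k i, |c k i| ≤ R := fun k i =>
    (Finset.single_le_sum (f := fun i => |c k i|) (fun _ _ => abs_nonneg _)
      (Finset.mem_univ i)).trans
    (Finset.single_le_sum (f := fun k => ∑ i, |c k i|)
      (fun _ _ => Finset.sum_nonneg fun _ _ => abs_nonneg _) (Finset.mem_univ k))
  have hR0 : 0 ≤ R := Finset.sum_nonneg fun _ _ => Finset.sum_nonneg fun _ _ => abs_nonneg _
  -- Measured from `q`, each coefficient lies in `[0, 2 * R]`, so the `d` of them sum to at most `2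
  -- * R * d`; the `1` ensures `K > 0`.
  let K : ℝ := 2 * R * d + 1
  have hK : 0 < K := by positivity
  let q : V := p - ∑ i, R • v i
  let b : Fin (d + 1) → V := Fin.cons q fun i => q + K • v i
  refine ⟨Finset.univ.image b, Finset.card_image_le.trans (by simp),
    convexHull_min ?_ (convex_convexHull ℝ _)⟩
  rintro _ ⟨k, rfl⟩
  rw [Finset.coe_image, mem_convexHull_image_iff]
  have hc : ∀ i, 0 ≤ (c k i + R) / K ∧ (c k i + R) ≤ 2 * R := fun i => by
    have := abs_le.1 (hR k i)
    exact ⟨div_nonneg (by linarith) hK.le, by linarith⟩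
  refine ⟨Fin.cons (1 - ∑ i, (c k i + R) / K) fun i => (c k i + R) / K, fun i => ?_,
    fun i hi => (hi (by simp)).elim, ?_, ?_⟩
  · refine Fin.cases ?_ (fun i => ?_) i
    · rw [Fin.cons_zero, sub_nonneg, ← Finset.sum_div, div_le_one hK]
      calc ∑ i, (c k i + R) ≤ ∑ _i : Fin d, 2 * R := Finset.sum_le_sum fun i _ => (hc i).2
        _ ≤ K := by simp [K]; linarith
    · exact (hc i).1
  · simp [Fin.sum_univ_succ]
  · rw [Fin.sum_univ_succ, ha]
    simp only [Fin.cons_zero, Fin.cons_succ, b, smul_add, Finset.sum_add_distrib, smul_smul,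
      ← Finset.sum_smul, div_mul_cancel₀ _ hK.ne', add_smul, sub_smul, one_smul, q]
    abel

theorem inSimplex_self {n k : ℕ} (a : Fin (k + 1) → E n) : InSimplex n a := by
  obtain ⟨s, hs, h⟩ := exists_finset_convexHull (0 : E n)
    (fun i => EuclideanSpace.basisFun (Fin n) ℝ i) a (fun k i => a k i) fun k => by
      ext j
      simp [Pi.single_apply]
  exact ⟨s, by exact_mod_cast hs, h⟩

/-- Independent points cannot lie in the affine span of fewer points; a dependent tuple spans a
direction of smaller dimension, where a large enclosing simplex exists. -/
theorem affineIndependent_iff_not_inSimplex {n : ℕ} (a : Fin (n + 1) → E n) :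
    AffineIndependent ℝ a ↔ ¬ InSimplex ((n : ℤ) - 1) a := by
  classical
  constructor
  · rintro ha ⟨s, hs, h⟩
    have h1 : Set.range a ⊆ affineSpan ℝ (s : Set (E n)) :=
      ((subset_convexHull ℝ _).trans h).trans (convexHull_subset_affineSpan _)
    have h2 : Set.range a = ((Finset.univ.image a : Finset (E n)) : Set (E n)) := by simp
    have h3 := ha.range
    rw [h2] at h1 h3
    have := AffineIndependent.card_le_card_of_subset_affineSpan (k := ℝ) h3 h1
    rw [Finset.card_image_of_injective _ ha.injective, Finset.card_univ, Fintype.card_fin] at this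
    omega
  · intro h
    by_contra ha
    apply h
    cases n with
    | zero =>
      have : Subsingleton (Fin (0 + 1)) := inferInstanceAs (Subsingleton (Fin 1))
      exact (ha (affineIndependent_of_subsingleton ℝ a)).elim
    | succ m =>
      rw [affineIndependent_iff_not_finrank_vectorSpan_le ℝ a (n := m) (by simp), not_not] at ha
      let W := vectorSpan ℝ (Set.range a)
      let b := Module.finBasis ℝ W
      have hmem : ∀ k, a k - a 0 ∈ W := fun k =>
        vsub_mem_vectorSpan ℝ (Set.mem_range_self k) (Set.mem_range_self 0)
      obtain ⟨s, hs, h⟩ := exists_finset_convexHull (a 0) (fun i => (b i : E (m + 1))) a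
        (fun k i => b.repr ⟨a k - a 0, hmem k⟩ i) fun k => by
          have := congrArg (Subtype.val) (b.sum_repr ⟨a k - a 0, hmem k⟩)
          rw [Submodule.coe_sum] at this
          simp only [Submodule.coe_smul] at this
          rw [this]
          abel
      refine ⟨s, ?_, h⟩
      push_cast
      have : (s.card : ℤ) ≤ m + 1 := by exact_mod_cast hs.trans (Nat.succ_le_succ ha)
      linarith

/-! ### The graded piece in the top degree -/

theorem rep_hom_ext {k G : Type} [CommRing k] [Group G] {X Y : Rep.{0} k G} {f g : X ⟶ Y}
    (h : ∀ x : X, f.hom x = g.hom x) : f = g :=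
  ConcreteCategory.hom_ext _ _ h

theorem rep_exact_exists {k G : Type} [CommRing k] [Group G] {S : ShortComplex (Rep.{0} k G)}
    (hS : S.Exact) (x : S.X₂) (hx : S.g.hom x = 0) : ∃ y : S.X₁, S.f.hom y = x :=
  (ShortComplex.moduleCat_exact_iff _).1 (hS.map (forget₂ (Rep.{0} k G) (ModuleCat.{0} k))) x hx

theorem gr_shortComplex_exact (n : ℕ) (p : ℤ) (k : ℕ) :
    (((ShortComplex.mk (filtIncl n (sub_le_self p zero_le_one)) (grπ n p)
      (Limits.cokernel.condition _)).map
        (HomologicalComplex.eval (Rep ℤ (Isom n)) (ComplexShape.down ℕ) k))).Exact :=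
  (ShortComplex.exact_cokernel (filtIncl n (sub_le_self p zero_le_one))).map _

instance (n : ℕ) (p : ℤ) : Epi (grπ n p) :=
  inferInstanceAs (Epi (Limits.cokernel.π _))

instance (n : ℕ) (p : ℤ) (k : ℕ) : Epi ((grπ n p).f k) :=
  inferInstanceAs (Epi ((HomologicalComplex.eval (Rep ℤ (Isom n)) (ComplexShape.down ℕ) k).map
    (grπ n p)))

theorem grπ_surjective (n : ℕ) (p : ℤ) (k : ℕ) : Function.Surjective ((grπ n p).f k).hom :=
  (Rep.epi_iff_surjective _).1 inferInstance

theorem grπ_eq_zero_iff (n : ℕ) (p : ℤ) (k : ℕ) (w : (filtChains n p).X k) :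
    (grπ n p).f k w = 0 ↔ (w : filt n p k).1 ∈ filt n (p - 1) k := by
  constructor
  · intro hw
    obtain ⟨x, hx⟩ := rep_exact_exists (gr_shortComplex_exact n p k) w hw
    have : (x : filt n (p - 1) k).1 = (w : filt n p k).1 := congrArg Subtype.val hx
    rw [← this]
    exact x.2
  · intro hw
    have h0 := congrArg (fun f => f.f k) (Limits.cokernel.condition (filtIncl n (sub_le_self p zero_le_one)))
    have := congrArg (fun f => f.hom ⟨_, hw⟩) h0
    exact this


/-- Each face has at most `j + 1 = p` distinct points and lies in their hull. Hence the differential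
of the `p`-th graded piece vanishes in degree `p`. -/
theorem boundary_mem_filt_sub_one {n j : ℕ} {p : ℤ} (hp : p = ((j + 1 : ℕ) : ℤ))
    (c : (Fin (j + 1 + 1) → E n) →₀ ℤ) : boundary n j c ∈ filt n (p - 1) j := by
  classical
  subst hp
  induction c using Finsupp.induction_linear with
  | zero => rw [map_zero]; exact Submodule.zero_mem _
  | add c d hc hd => rw [map_add]; exact Submodule.add_mem _ hc hd
  | single a z =>
    rw [← mul_one z, ← smul_eq_mul, ← Finsupp.smul_single, map_smul, boundary_single]
    refine Submodule.smul_mem _ _ (Submodule.sum_mem _ fun i _ => Submodule.smul_mem _ _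
      (Submodule.subset_span ⟨_, ⟨Finset.univ.image (a ∘ i.succAbove), ?_,
        by rw [Finset.coe_image, Finset.coe_univ, Set.image_univ]⟩, rfl⟩))
    have : (Finset.univ.image (a ∘ i.succAbove)).card ≤ j + 1 :=
      Finset.card_image_le.trans (by simp)
    omega

theorem gr_d_eq_zero (n j : ℕ) : (gr n n).d n j = 0 := by
  by_cases h : j + 1 = n
  swap
  · exact (gr n n).shape _ _ h
  subst h
  rw [← cancel_epi ((grπ (j + 1) ((j + 1 : ℕ) : ℤ)).f (j + 1)), Limits.comp_zero,
    (grπ (j + 1) ((j + 1 : ℕ) : ℤ)).comm, filtChains_d]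
  refine rep_hom_ext fun w => ?_
  refine (grπ_eq_zero_iff _ _ _ _).2 ?_
  change boundary (j + 1) j (w : filt (j + 1) _ (j + 1)).1 ∈ _
  refine boundary_mem_filt_sub_one rfl _

theorem mem_filt_self {n k : ℕ} (c : (Fin (k + 1) → E n) →₀ ℤ) : c ∈ filt n n k := by
  induction c using Finsupp.induction_linear with
  | zero => exact Submodule.zero_mem _
  | add c d hc hd => exact Submodule.add_mem _ hc hd
  | single a z =>
    rw [← mul_one z, ← smul_eq_mul, ← Finsupp.smul_single]
    exact Submodule.smul_mem _ _ (Submodule.subset_span ⟨a, inSimplex_self a, rfl⟩)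

/-- The signed class map `C_n(E n) → Pt n`, up to a global sign `s`. -/
def signedClassHom (n : ℕ) (s : ℤ) : Rep.of (tupleAction n n) ⟶ Pt n :=
  Rep.ofHom ⟨(cutRelations n).mkQ ∘ₗ (s • chainToPolytopes n), fun g => by
    refine LinearMap.ext fun c => ?_
    change (cutRelations n).mkQ (s • chainToPolytopes n (tupleAction n n g c)) =
      (cutRelations n).mkQ (freePolytopeAction n g (s • chainToPolytopes n c))
    rw [chainToPolytopes_tupleAction, (freePolytopeAction n g).map_smul]⟩

theorem signedClassHom_apply (n : ℕ) (s : ℤ) (c : (Fin (n + 1) → E n) →₀ ℤ) :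
    (signedClassHom n s).hom c = (cutRelations n).mkQ (s • chainToPolytopes n c) := rfl

theorem signedClassHom_surjective {n : ℕ} {s : ℤ} (hs : s * s = 1) :
    Function.Surjective (signedClassHom n s).hom := fun x => by
  obtain ⟨c, hc⟩ := mkQ_chainToPolytopes_surjective n x
  refine ⟨s • c, ?_⟩
  have h : s • chainToPolytopes n (s • c) = chainToPolytopes n c := by
    rw [map_smul, smul_smul, hs, one_smul]
  rw [← hc, signedClassHom_apply, h]
  rfl

theorem signedClassHom_eq_zero_of_mem_trivialChains {n : ℕ} (s : ℤ)
    {c : (Fin (n + 1) → E n) →₀ ℤ} (hc : c ∈ trivialChains n) :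
    (signedClassHom n s).hom c = 0 := by
  rw [signedClassHom_apply]
  refine (Submodule.Quotient.mk_eq_zero _).2 (Submodule.smul_mem _ _ ?_)
  suffices h : trivialChains n ≤ (cutRelations n).comap (chainToPolytopes n) from h hc
  refine sup_le (Submodule.span_le.2 ?_) ?_
  · rintro _ ⟨a, ha, rfl⟩
    change chainToPolytopes n _ ∈ cutRelations n
    rw [chainToPolytopes_single, signedSimplex, ha, sign_zero]
    simp
  · rintro _ ⟨d, rfl⟩
    exact chainToPolytopes_boundary_mem d

theorem mem_trivialChains_of_signedClassHom_eq_zero {n : ℕ} {s : ℤ} (hs : s * s = 1)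
    {c : (Fin (n + 1) → E n) →₀ ℤ} (hc : (signedClassHom n s).hom c = 0) :
    c ∈ trivialChains n := by
  rw [signedClassHom_apply] at hc
  have h1 := (Submodule.Quotient.mk_eq_zero _).1 hc
  have h2 := Submodule.smul_mem _ s h1
  rw [smul_smul, hs, one_smul] at h2
  exact mem_trivialChains_of_chainToPolytopes_mem c h2

theorem filt_sub_one_le_trivialChains (n : ℕ) : filt n ((n : ℤ) - 1) n ≤ trivialChains n := by
  refine Submodule.span_le.2 ?_
  rintro _ ⟨a, ha, rfl⟩
  refine single_mem_trivialChains ?_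
  by_contra h
  exact (affineIndependent_iff_not_inSimplex a).1 ((volDet_ne_zero_iff a).1 h) ha

theorem single_mem_filt_sub_one {n : ℕ} {a : Fin (n + 1) → E n} (ha : volDet a = 0) :
    Finsupp.single a 1 ∈ filt n ((n : ℤ) - 1) n := by
  refine Submodule.subset_span ⟨a, ?_, rfl⟩
  by_contra h
  exact (volDet_ne_zero_iff a).2 ((affineIndependent_iff_not_inSimplex a).2 h) ha

/-! ### The induced map on homology -/

theorem exists_grDesc (n : ℕ) (s : ℤ) : ∃ φ' : (gr n n).X n ⟶ Pt n,
    (grπ n n).f n ≫ φ' = (filtι n n).f n ≫ signedClassHom n s := by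
  have hex := gr_shortComplex_exact n n n
  have : Epi ((ShortComplex.mk (filtIncl n (sub_le_self (n : ℤ) zero_le_one)) (grπ n n)
      (Limits.cokernel.condition _)).map
        (HomologicalComplex.eval (Rep ℤ (Isom n)) (ComplexShape.down ℕ) n)).g :=
    inferInstanceAs (Epi ((grπ n n).f n))
  refine ⟨hex.desc ((filtι n n).f n ≫ signedClassHom n s) ?_, hex.g_desc _ _⟩
  refine rep_hom_ext fun w => ?_
  exact signedClassHom_eq_zero_of_mem_trivialChains s
    (filt_sub_one_le_trivialChains n (w : filt n ((n : ℤ) - 1) n).2)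

theorem exists_homologyIso (n : ℕ) {s : ℤ} (hs : s * s = 1) (φ' : (gr n n).X n ⟶ Pt n)
    (hφ' : (grπ n n).f n ≫ φ' = (filtι n n).f n ≫ signedClassHom n s) :
    ∃ e : (gr n n).homology n ≅ Pt n,
      (gr n n).homologyπ n ≫ e.hom = (gr n n).iCycles n ≫ φ' := by
  have hφ'_apply : ∀ w : (filtChains n n).X n,
      φ'.hom ((grπ n n).f n w) = (signedClassHom n s).hom (w : filt n n n).1 := fun w =>
    congrArg (fun f => f.hom w) hφ'
  -- With zero outgoing differential every chain is a cycle, so homology is the cokernel of the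
  -- incoming differential.
  have hiso : IsIso ((gr n n).iCycles n) :=
    (gr n n).isIso_iCycles n _ rfl (gr_d_eq_zero n _)
  have hzero : (gr n n).toCycles (n + 1) n ≫ (gr n n).iCycles n ≫ φ' = 0 := by
    rw [(gr n n).toCycles_i_assoc, ← cancel_epi ((grπ n n).f (n + 1)), Limits.comp_zero,
      (grπ n n).comm_assoc, hφ', filtChains_d]
    refine rep_hom_ext fun w => ?_
    exact signedClassHom_eq_zero_of_mem_trivialChains s
      (boundary_mem_trivialChains (w : filt n n (n + 1)).1)
  have hcok := (gr n n).homologyIsCokernel (n + 1) n (by simp)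
  let f : (gr n n).homology n ⟶ Pt n := hcok.desc (Limits.CokernelCofork.ofπ _ hzero)
  have hf : (gr n n).homologyπ n ≫ f = (gr n n).iCycles n ≫ φ' :=
    hcok.fac _ Limits.WalkingParallelPair.one
  have hepi : Epi f := by
    have h1 : Epi φ' := by
      have : Epi ((grπ n n).f n ≫ φ') := by
        rw [Rep.epi_iff_surjective, hφ']
        intro x
        obtain ⟨c, hc⟩ := signedClassHom_surjective hs x
        exact ⟨(⟨c, mem_filt_self c⟩ : filt n n n), hc⟩
      exact epi_of_epi ((grπ n n).f n) φ'
    have h2 : Epi ((gr n n).homologyπ n ≫ f) := by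
      rw [hf]
      infer_instance
    exact epi_of_epi ((gr n n).homologyπ n) f
  have hmono : Mono f := by
    rw [Rep.mono_iff_injective]
    refine (injective_iff_map_eq_zero _).2 fun y hy => ?_
    obtain ⟨z, rfl⟩ := (Rep.epi_iff_surjective ((gr n n).homologyπ n)).1 inferInstance y
    obtain ⟨w, hw⟩ := grπ_surjective n n n ((gr n n).iCycles n z)
    have h1 : f.hom ((gr n n).homologyπ n z) = φ'.hom ((gr n n).iCycles n z) :=
      congrArg (fun g => g.hom z) hf
    have h2 : (signedClassHom n s).hom (w : filt n n n).1 = 0 := by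
      rw [← hφ'_apply, ← hy, h1]
      exact congrArg φ'.hom hw
    -- Split the representative as degenerate part plus boundary: the former dies in the graded
    -- piece, the latter in homology.
    obtain ⟨d, hd, b, ⟨v, rfl⟩, hdv⟩ :=
      Submodule.mem_sup.1 (mem_trivialChains_of_signedClassHom_eq_zero hs h2)
    let v' : (filtChains n n).X (n + 1) := (⟨v, mem_filt_self v⟩ : filt n n (n + 1))
    have hd' : d ∈ filt n ((n : ℤ) - 1) n := by
      refine Submodule.span_le.2 ?_ hd
      rintro _ ⟨a, ha, rfl⟩
      exact single_mem_filt_sub_one ha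
    have h3 : (grπ n n).f n (w - (filtChains n n).d (n + 1) n v') = 0 := by
      rw [grπ_eq_zero_iff, filtChains_d]
      change (w : filt n n n).1 - boundary n n v ∈ _
      rwa [← hdv, add_sub_cancel_right]
    have h4 : (gr n n).iCycles n z =
        (gr n n).iCycles n ((gr n n).toCycles (n + 1) n ((grπ n n).f (n + 1) v')) := by
      have h5 : (gr n n).iCycles n ((gr n n).toCycles (n + 1) n ((grπ n n).f (n + 1) v')) =
          (gr n n).d (n + 1) n ((grπ n n).f (n + 1) v') :=
        congrArg (fun g => g.hom ((grπ n n).f (n + 1) v')) ((gr n n).toCycles_i (n + 1) n)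
      have h6 : (gr n n).d (n + 1) n ((grπ n n).f (n + 1) v') =
          (grπ n n).f n ((filtChains n n).d (n + 1) n v') :=
        congrArg (fun g => g.hom v') ((grπ n n).comm (n + 1) n)
      rw [h5, h6, ← sub_eq_zero]
      refine Eq.trans ?_ h3
      refine Eq.trans ?_ (map_sub ((grπ n n).f n).hom w _).symm
      exact congrArg (· - (grπ n n).f n ((filtChains n n).d (n + 1) n v')) hw.symm
    have h7 := (Rep.mono_iff_injective ((gr n n).iCycles n)).1 inferInstance h4
    rw [h7]
    exact congrArg (fun g => g.hom ((grπ n n).f (n + 1) v'))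
      ((gr n n).toCycles_comp_homologyπ (n + 1) n)
  have : IsIso f := isIso_of_mono_of_epi f
  exact ⟨asIso f, hf⟩

end PolytopeModule

end

theorem mainTheorem12 (n : ℕ) (o : Orientation ℝ (E n) (Fin n)) :
    -- a tuple is nondegenerate iff it is nonzero in the `n`-th graded piece
    (∀ a : Fin (n + 1) → E n, AffineIndependent ℝ a ↔ ¬ InSimplex ((n : ℤ) - 1) a) ∧
    -- the map of `Isom n`-modules `C_n(E n) → Pt n`
    ∃ φ : (chains n).X n ⟶ Pt n,
      (∀ (a : Fin (n + 1) → E n) (ha : AffineIndependent ℝ a),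
        φ (simplexChain a) = orientationSign o a • polytopeClass (simplexPolytope a ha)) ∧
      (∀ a : Fin (n + 1) → E n, ¬ AffineIndependent ℝ a → φ (simplexChain a) = 0) ∧
      -- it factors through the graded piece and induces an isomorphism on homology
      ∃ φ' : (gr n n).X n ⟶ Pt n,
        (grπ n n).f n ≫ φ' = (filtι n n).f n ≫ φ ∧
        ∃ e : (gr n n).homology n ≅ Pt n,
          (gr n n).homologyπ n ≫ e.hom = (gr n n).iCycles n ≫ φ' ∧
          -- every tuple defines a homology class, which `e` sends to the value of `φ`
          ∀ a : Fin (n + 1) → E n,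
            ∃ (w : (filtChains n n).X n) (z : (gr n n).cycles n),
              (filtι n n).f n w = simplexChain a ∧
              (gr n n).iCycles n z = (grπ n n).f n w ∧
              e.hom ((gr n n).homologyπ n z) = φ (simplexChain a) := by
  obtain ⟨s, hs, hsign⟩ := orientationSign_eq o
  obtain ⟨φ', hφ'⟩ := exists_grDesc n s
  obtain ⟨e, he⟩ := exists_homologyIso n hs φ' hφ'
  refine ⟨affineIndependent_iff_not_inSimplex, signedClassHom n s, fun a ha => ?_, fun a ha => ?_,
    φ', hφ', e, he, fun a => ?_⟩
  · change (cutRelations n).mkQ (s • chainToPolytopes n (Finsupp.single a 1)) = _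
    rw [chainToPolytopes_single, signedSimplex, tuplePolytope_of_affineIndependent ha,
      Finsupp.smul_single, smul_eq_mul, ← hsign a ((volDet_ne_zero_iff a).2 ha), ← mul_one
      (orientationSign o a), ← smul_eq_mul, ← Finsupp.smul_single, map_smul, smul_eq_mul, mul_one]
    rfl
  · exact signedClassHom_eq_zero_of_mem_trivialChains s
      (single_mem_trivialChains (not_not.1 fun h => ha ((volDet_ne_zero_iff a).1 h)))
  · let w : (filtChains n n).X n :=
      (⟨Finsupp.single a 1, mem_filt_self _⟩ : filt n n n)
    -- Again every element of degree `n` is a cycle, so the tuple has a homology class whether or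
    -- not it is degenerate.
    have hiso : IsIso ((gr n n).iCycles n) :=
      (gr n n).isIso_iCycles n _ rfl (gr_d_eq_zero n _)
    obtain ⟨z, hz⟩ := (Rep.epi_iff_surjective ((gr n n).iCycles n)).1 inferInstance
      ((grπ n n).f n w)
    refine ⟨w, z, rfl, hz, ?_⟩
    have h1 : e.hom ((gr n n).homologyπ n z) = φ' ((gr n n).iCycles n z) :=
      congrArg (fun g => g.hom z) he
    have h2 : φ' ((grπ n n).f n w) = (signedClassHom n s).hom (Finsupp.single a 1) :=
      congrArg (fun g => g.hom w) hφ'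
    rw [h1]
    exact (congrArg φ'.hom hz).trans h2
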